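/- Let $p\geq 7$ be a prime and let $\mathrm{PG}(2,p^2)$ be the Desarguesian projective plane over the finite field with $p^2$ elements. Let $\mathrm{C}(2,p^2)$ be its $p$-ary code, that is, the $\mathbb{F}_p$-span, inside the space of $\mathbb{F}_p$-valued vectors indexed by the points of $\mathrm{PG}(2,p^2)$, of the incidence vectors of the lines, and let $\mathrm{C}(2,p^2)^\perp$ be its dual code, that is, the set of all vectors whose standard dot product with every vector of $\mathrm{C}(2,p^2)$ is $0$. Then the minimum weight $d^\perp$ of $\mathrm{C}(2,p^2)^\perp$ (the smallest number of nonzero entries of a nonzero vector of $\mathrm{C}(2,p^2)^\perp$) satisfies $$2p^2-2p+5\leq d^\perp\leq 2p^2-p.$$ -/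

import Mathlib

open scoped LinearAlgebra.Projectivization

namespace PlaneCode

/-- The incidence matrix, with entries in `R`, of a point-line geometry with point set `P` and line
set `L`: rows are indexed by lines, columns by points, and the entry at `(l, x)` is `1` if the
point `x` lies on the line `l` and `0` otherwise. -/
noncomputable def incidenceMatrix (R P L : Type*) [Zero R] [One R] [Membership P L] :
    Matrix L P R :=
  open Classical in Matrix.of fun l x => if x ∈ l then 1 else 0

/-- The `p`-ary code of a point-line geometry: the span over `ZMod p` of the rows of its incidence
matrix. -/
noncomputable def code (p : ℕ) (P L : Type*) [Membership P L] : Submodule (ZMod p) (P → ZMod p) :=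
  Submodule.span (ZMod p) (Set.range (incidenceMatrix (ZMod p) P L).row)

/-- The dual of a linear code with respect to the standard dot product. -/
def dualCode {R ι : Type*} [CommSemiring R] [Fintype ι] (C : Submodule R (ι → R)) :
    Submodule R (ι → R) where
  carrier := {v | ∀ c ∈ C, v ⬝ᵥ c = 0}
  zero_mem' := fun c _ => zero_dotProduct c
  add_mem' := fun {a b} ha hb c hc => by rw [add_dotProduct, ha c hc, hb c hc, add_zero]
  smul_mem' := fun r v hv c hc => by rw [smul_dotProduct, hv c hc, smul_zero]

/-- `d` is the minimum weight of the linear code `C`: the smallest Hamming weight of a nonzero code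
word. (In particular, `C` has a nonzero code word.) -/
def IsMinWeight {R ι : Type*} [CommSemiring R] [DecidableEq R] [Fintype ι]
    (C : Submodule R (ι → R)) (d : ℕ) : Prop :=
  IsLeast {w : ℕ | ∃ c ∈ C, c ≠ 0 ∧ hammingNorm c = w} d

/-- The `p`-ary code `C(2,q)` of the Desarguesian projective plane `PG(2,q)` over the field `K` with
`q` elements. Points and lines are both given by homogeneous coordinates in `K³`, and a point `x`
is on the line `l` exactly when the dot product of their coordinate vectors vanishes. -/
noncomputable abbrev desarguesianCode (p : ℕ) (K : Type*) [Field K] :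
    Submodule (ZMod p) (ℙ K (Fin 3 → K) → ZMod p) :=
  code p (ℙ K (Fin 3 → K)) (ℙ K (Fin 3 → K))

end PlaneCode

/-! The upper bound comes from an explicit word: 1 on the p² affine points over F_p and -1 on the p²
- p points at infinity whose slope lies outside F_p. An affine line of such a slope meets each of
the two sets in one point, and every other line meets both in a multiple of p points (`card_congr`).

For the lower bound let c be a nonzero dual word of weight w ≤ 2p² - 2p + 4, and lift its values to
0, ..., p - 1. At a point x with c x = 1, the other lifts on each line through x sum to p(1 + k) - 1
with k ≥ 0. Summing over the pencil expresses the total of all lifts through a = Σ k. The same for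
-c, with excess a', and addition give w + 2p = 2p² + 2 + a + a', so a + a' ≤ 2 and almost all lines
are extremal. On an extremal line a value -y is compensated by smaller positive values, which
compares the multiplicities of ±y and ±1 (`weight_eq_of_eq_one`). After rescaling, any occurring
value can play the role of 1, and the comparisons show that the nonzero values are either one pair
±α or all of F_p^* (`two_valued_or_full`).

If all values occur, they occur almost equally often. A weight on pairs of values is chosen whose
sum over any zero-sum configuration is bounded below linearly in its size. Double counting over the
lines (`quadratic_bound`) then contradicts the near-constancy. One weight handles p ≥ 11, another,
built from the quadratic character, handles p = 7.

If only ±α occur, the points of value α form a set of p² - p + 1 or p² - p + 2 points whose secants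
carry p points, in the second case with one exceptional two-point secant through each point
(`two_valued_structure`). With a secant sent to infinity this becomes a net in the affine plane. Its
lines give homotheties of the set of first coordinates, their commutator is a translation, so that
set has at least p elements; when it has exactly p, the holes of the resulting grid lead to a
contradiction (`IsNet.not_isNet`). -/

namespace PlaneCode

/-! ### Lifted sums on a single line -/

section Line

variable {ι : Type*} {p : ℕ} {s : Finset ι} {c : ι → ZMod p} {y : ℕ}

theorem card_mul_le_sum {f : ι → ℕ} (Q : ι → Prop) [DecidablePred Q] {b : ℕ}
    (h : ∀ i ∈ s, Q i → b ≤ f i) : (s.filter Q).card * b ≤ ∑ i ∈ s, f i := by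
  calc (s.filter Q).card * b ≤ ∑ i ∈ s.filter Q, f i := by
        rw [← smul_eq_mul]
        exact Finset.card_nsmul_le_sum _ _ _ fun i hi =>
          h i (Finset.mem_filter.1 hi).1 (Finset.mem_filter.1 hi).2
    _ ≤ ∑ i ∈ s, f i := Finset.sum_le_sum_of_subset (Finset.filter_subset _ _)

/-- Each counted lift is at least p - y > p/2, while all lifts together stay below p(1 + k). -/
theorem card_neg_le (hy : 2 * y < p) {k : ℕ} (hk : ∑ i ∈ s, (c i).val + 1 = p * (1 + k)) :
    (s.filter fun i => p ≤ (c i).val + y ∧ (c i).val + 2 ≤ p).card ≤ 1 + 2 * k := by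
  have h := card_mul_le_sum (s := s) (f := fun i => (c i).val) (b := p - y)
    (fun i => p ≤ (c i).val + y ∧ (c i).val + 2 ≤ p) (fun i _ h => by omega)
  set n := (s.filter fun i => p ≤ (c i).val + y ∧ (c i).val + 2 ≤ p).card
  by_contra hn
  push Not at hn
  have h1 : (2 + 2 * k) * (p - y) ≤ n * (p - y) := Nat.mul_le_mul_right _ (by omega)
  have h2 : (1 + k) * (p + 1) ≤ (1 + k) * (2 * (p - y)) := Nat.mul_le_mul_left _ (by omega)
  nlinarith

/-- The lifts total p - 1, so a value between -y and -2 leaves a remainder between 1 and y - 1,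
which consists of lifts below y. A value -1 would leave nothing, hence its exclusion. -/
theorem exists_pos_of_neg {i : ι} (hi : i ∈ s) (hsum : ∑ i ∈ s, (c i).val + 1 = p)
    (h1 : p ≤ (c i).val + y) (h2 : (c i).val + 2 ≤ p) :
    ∃ j ∈ s, j ≠ i ∧ 1 ≤ (c j).val ∧ (c j).val < y := by
  classical
  have h := Finset.add_sum_erase s (fun i => (c i).val) hi
  have hpos : 0 < ∑ j ∈ s.erase i, (c j).val := by omega
  obtain ⟨j, hj, hj0⟩ := Finset.sum_pos_iff.1 hpos
  have hle : (c j).val ≤ ∑ j ∈ s.erase i, (c j).val :=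
    Finset.single_le_sum (f := fun j => (c j).val) (fun _ _ => Nat.zero_le _) hj
  rw [Finset.mem_erase] at hj
  exact ⟨j, hj.2, hj.1, hj0, by omega⟩

/-- Here the remainder is exactly y - 1. Since no single value equals y - 1, at least two entries
share it. -/
theorem exists_two_pos_of_neg {i : ι} (hi : i ∈ s) (hsum : ∑ i ∈ s, (c i).val + 1 = p)
    (h1 : p = (c i).val + y) (h2 : (c i).val + 2 ≤ p) (hne : ∀ j ∈ s, (c j).val + 1 ≠ y) :
    1 < (s.filter fun i => 1 ≤ (c i).val ∧ (c i).val < y).card := by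
  classical
  obtain ⟨j, hj, hji, hj1, hj2⟩ := exists_pos_of_neg hi hsum h1.le h2
  have h := Finset.add_sum_erase s (fun i => (c i).val) hi
  have h' := Finset.add_sum_erase (s.erase i) (fun i => (c i).val) (Finset.mem_erase.2 ⟨hji, hj⟩)
  have hpos : 0 < ∑ j ∈ (s.erase i).erase j, (c j).val := by
    have := hne j hj
    omega
  obtain ⟨l, hl, hl0⟩ := Finset.sum_pos_iff.1 hpos
  have hle : (c l).val ≤ ∑ j ∈ (s.erase i).erase j, (c j).val :=
    Finset.single_le_sum (f := fun j => (c j).val) (fun _ _ => Nat.zero_le _) hl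
  rw [Finset.mem_erase, Finset.mem_erase] at hl
  refine Finset.one_lt_card.2 ⟨j, ?_, l, ?_, Ne.symm hl.1⟩
  · exact Finset.mem_filter.2 ⟨hj, hj1, hj2⟩
  · refine Finset.mem_filter.2 ⟨hl.2.2, hl0, ?_⟩
    omega

/-- For k = 0 there is at most one negative entry and it forces a positive companion. For k ≥ 1 the
bound 1 + 2k ≤ 3k is enough. -/
theorem card_neg_le_card_pos (hy : 2 * y < p) {k : ℕ}
    (hk : ∑ i ∈ s, (c i).val + 1 = p * (1 + k)) :
    (s.filter fun i => p ≤ (c i).val + y ∧ (c i).val + 2 ≤ p).card ≤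
      (s.filter fun i => 1 ≤ (c i).val ∧ (c i).val < y).card + 3 * k := by
  have h := card_neg_le hy hk
  obtain rfl | hk0 := Nat.eq_zero_or_pos k
  · obtain h0 | ⟨i, hi⟩ :=
        (s.filter fun i => p ≤ (c i).val + y ∧ (c i).val + 2 ≤ p).eq_empty_or_nonempty
    · simp [h0]
    · rw [Finset.mem_filter] at hi
      obtain ⟨j, hj, _, hj1⟩ := exists_pos_of_neg hi.1 (by simpa using hk) hi.2.1 hi.2.2
      have : 0 < (s.filter fun i => 1 ≤ (c i).val ∧ (c i).val < y).card :=
        Finset.card_pos.2 ⟨j, Finset.mem_filter.2 ⟨hj, hj1⟩⟩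
      omega
  · omega

theorem card_neg_add_le_card_pos (hy2 : 2 ≤ y) (hy : 2 * y < p) {k : ℕ}
    (hk : ∑ i ∈ s, (c i).val + 1 = p * (1 + k)) (hne : ∀ j ∈ s, (c j).val + 1 ≠ y) :
    (s.filter fun i => p ≤ (c i).val + y ∧ (c i).val + 2 ≤ p).card +
        (s.filter fun i => p = (c i).val + y).card ≤
      (s.filter fun i => 1 ≤ (c i).val ∧ (c i).val < y).card + 6 * k := by
  have h := card_neg_le hy hk
  have hsub : (s.filter fun i => p = (c i).val + y).card ≤
      (s.filter fun i => p ≤ (c i).val + y ∧ (c i).val + 2 ≤ p).card := by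
    refine Finset.card_le_card fun i hi => ?_
    simp only [Finset.mem_filter] at hi ⊢
    exact ⟨hi.1, by omega, by omega⟩
  obtain rfl | hk0 := Nat.eq_zero_or_pos k
  · have h3 := card_neg_le_card_pos hy hk
    obtain h0 | ⟨i, hi⟩ := (s.filter fun i => p = (c i).val + y).eq_empty_or_nonempty
    · rw [h0]
      simpa using h3
    · rw [Finset.mem_filter] at hi
      have := exists_two_pos_of_neg hi.1 (by simpa using hk) hi.2 (by omega) hne
      omega
  · omega

variable [Fact p.Prime]

theorem val_eq_pred_iff {x : ZMod p} : x.val = p - 1 ↔ x = -1 := by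
  have h1 : ((-1 : ZMod p)).val = p - 1 := by
    rw [ZMod.neg_val, if_neg one_ne_zero, ZMod.val_one]
  rw [← h1]
  exact ⟨fun h => ZMod.val_injective p h, fun h => by rw [h]⟩

theorem exists_sum_val_add_one (hs : ∑ i ∈ s, c i = -1) :
    ∃ k : ℕ, ∑ i ∈ s, (c i).val + 1 = p * (1 + k) := by
  have h : ((∑ i ∈ s, (c i).val + 1 : ℕ) : ZMod p) = 0 := by
    push_cast
    simp only [ZMod.natCast_zmod_val, hs]
    ring
  obtain ⟨m, hm⟩ := (ZMod.natCast_eq_zero_iff _ _).1 h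
  obtain _ | m := m
  · simp at hm
  · exact ⟨m, by rw [hm, add_comm]⟩

/-- Every lift is at most p - 2 except that of -1, which is p - 1. A sum just below p(1 + k)
therefore needs more than 1 + k nonzero entries, those equal to -1 being counted twice. -/
theorem two_add_le_card {k : ℕ} (hk : ∑ i ∈ s, (c i).val + 1 = p * (1 + k)) :
    2 + k ≤ (s.filter fun i => c i ≠ 0).card + (s.filter fun i => c i = -1).card := by
  classical
  have hp := (Fact.out : p.Prime).two_le
  have hle : ∑ i ∈ s, (c i).val ≤ (s.filter fun i => c i ≠ 0).card * (p - 2) +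
      (s.filter fun i => c i = -1).card := by
    rw [Finset.card_filter, Finset.card_filter, Finset.sum_mul, ← Finset.sum_add_distrib]
    refine Finset.sum_le_sum fun i _ => ?_
    have hv := ZMod.val_lt (c i)
    by_cases h0 : c i = 0
    · simp [h0]
    by_cases h1 : c i = -1
    · rw [if_pos h0, if_pos h1, val_eq_pred_iff.2 h1]
      omega
    · have := mt val_eq_pred_iff.1 h1
      rw [if_pos h0, if_neg h1]
      omega
  have hsub : (s.filter fun i => c i = -1).card ≤ (s.filter fun i => c i ≠ 0).card := by
    refine Finset.card_le_card fun i hi => ?_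
    simp only [Finset.mem_filter] at hi ⊢
    exact ⟨hi.1, by rw [hi.2]; simp⟩
  set a := (s.filter fun i => c i ≠ 0).card
  set b := (s.filter fun i => c i = -1).card
  obtain ⟨r, rfl⟩ : ∃ r, p = r + 2 := ⟨p - 2, by omega⟩
  simp only [Nat.add_sub_cancel] at hle
  by_contra hlt
  push Not at hlt
  have h1 : a * r ≤ (1 + k - b) * r := Nat.mul_le_mul_right _ (by omega)
  have h2 : (r + 2) * (1 + k) = (1 + k) * r + 2 * (1 + k) := by ring
  have h3 : (1 + k - b) * r ≤ (1 + k) * r := Nat.mul_le_mul_right _ (by omega)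
  omega

end Line

open Configuration Classical

/-! ### The pencil of lines through a point -/

section Pencil

variable {P L : Type*} [Membership P L] [ProjectivePlane P L] [Fintype L]

/-- The lines through a point. -/
noncomputable def pencil (L : Type*) {P : Type*} [Membership P L] [Fintype L] (x : P) : Finset L :=
  Finset.univ.filter fun l => x ∈ l

/-- The points of a line other than a given point. -/
noncomputable def others {P L : Type*} [Membership P L] [Fintype P] (x : P) (l : L) : Finset P :=
  Finset.univ.filter fun z => z ∈ l ∧ z ≠ x

theorem card_pencil [Finite P] (x : P) : (pencil L x).card = ProjectivePlane.order P L + 1 := by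
  rw [← ProjectivePlane.lineCount_eq L x, lineCount, Nat.card_eq_fintype_card, Fintype.card_subtype]
  rfl

theorem card_common_lines {x z : P} (h : z ≠ x) :
    ((Finset.univ : Finset L).filter fun l => x ∈ l ∧ z ∈ l).card = 1 := by
  rw [Finset.card_eq_one]
  refine ⟨HasLines.mkLine h, Finset.eq_singleton_iff_unique_mem.2 ⟨?_, fun l hl => ?_⟩⟩
  · simp [(HasLines.mkLine_ax (L := L) h).1, (HasLines.mkLine_ax (L := L) h).2]
  · simp only [Finset.mem_filter, Finset.mem_univ, true_and] at hl
    exact (Nondegenerate.eq_or_eq (HasLines.mkLine_ax (L := L) h).1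
      (HasLines.mkLine_ax (L := L) h).2 hl.2 hl.1).resolve_left h |>.symm

variable [Fintype P]

theorem sum_pencil {M : Type*} [AddCommMonoid M] (x : P) (f : P → M) :
    ∑ l ∈ pencil L x, ∑ z ∈ others x l, f z = ∑ z ∈ Finset.univ.erase x, f z := by
  rw [Finset.sum_comm' (t' := Finset.univ.erase x)
    (s' := fun z => Finset.univ.filter fun l => x ∈ l ∧ z ∈ l)]
  · refine Finset.sum_congr rfl fun z hz => ?_
    rw [Finset.sum_const, card_common_lines (Finset.mem_erase.1 hz).1, one_smul]
  · intro l z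
    simp only [pencil, others, Finset.mem_filter, Finset.mem_univ, true_and, Finset.mem_erase,
      and_true]
    tauto

theorem sum_pencil_card (x : P) (Q : P → Prop) [DecidablePred Q] :
    ∑ l ∈ pencil L x, ((others x l).filter Q).card =
      ((Finset.univ.erase x).filter Q).card := by
  simp only [Finset.card_filter]
  exact sum_pencil x _

end Pencil

/-! ### Line estimates summed over a pencil -/

section Codeword

variable {P : Type*} [Fintype P] {p : ℕ}

/-- The number of coordinates of a vector that are equal to a given value. -/
noncomputable def cnt (c : P → ZMod p) (a : ZMod p) : ℕ :=
  (Finset.univ.filter fun z => c z = a).card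

theorem card_filter_erase {Q : P → Prop} [DecidablePred Q] {x : P} (h : ¬ Q x) :
    ((Finset.univ.erase x).filter Q).card = (Finset.univ.filter Q).card := by
  rw [Finset.filter_erase, Finset.erase_eq_of_notMem]
  simp [h]

theorem card_filter_erase_add_one {Q : P → Prop} [DecidablePred Q] {x : P} (h : Q x) :
    ((Finset.univ.erase x).filter Q).card + 1 = (Finset.univ.filter Q).card := by
  rw [Finset.filter_erase, Finset.card_erase_add_one]
  simp [h]

theorem sum_others_of_eq_one {L : Type*} [Membership P L] {c : P → ZMod p} {x : P}
    (hx : c x = 1) {l : L} (hl : x ∈ l)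
    (h : ∑ z with z ∈ l, c z = 0) : ∑ z ∈ others x l, c z = -1 := by
  have h1 : others x l = (Finset.univ.filter fun z => z ∈ l).erase x := by
    ext z
    simp [others, and_comm]
  have h2 := Finset.add_sum_erase (Finset.univ.filter fun z => z ∈ l) c (a := x) (by simp [hl])
  rw [h1]
  rw [h, hx] at h2
  exact eq_neg_of_add_eq_zero_right h2

variable [Fact p.Prime]

/-- Here k measures how far the lifted sum on a line exceeds its minimum p - 1. The line estimates
are added up over the pencil, which partitions the points other than x. The point x itself, of value
1, accounts for the 3 in 2q + 3 and for the summands 1 in the last two bounds. -/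
theorem pencil_bounds (hp3 : 3 ≤ p) (L : Type*) [Membership P L] [ProjectivePlane P L] [Fintype L]
    {c : P → ZMod p} (hc : ∀ l : L, ∑ z with z ∈ l, c z = 0) {x : P}
    (hx : c x = 1) :
    ∃ k : L → ℕ, (∀ l ∈ pencil L x, ∑ z ∈ others x l, (c z).val + 1 = p * (1 + k l)) ∧
      ∑ z, (c z).val + ProjectivePlane.order P L =
        p * (ProjectivePlane.order P L + 1 + ∑ l ∈ pencil L x, k l) ∧
      2 * ProjectivePlane.order P L + 3 + ∑ l ∈ pencil L x, k l ≤ hammingNorm c + cnt c (-1) ∧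
      (∀ y, 2 ≤ y → 2 * y < p →
        (Finset.univ.filter fun i => p ≤ (c i).val + y ∧ (c i).val + 2 ≤ p).card + 1 ≤
        (Finset.univ.filter fun i => 1 ≤ (c i).val ∧ (c i).val < y).card +
          3 * ∑ l ∈ pencil L x, k l) ∧
      (∀ y, 2 ≤ y → 2 * y < p → (∀ z, (c z).val + 1 ≠ y) →
        (Finset.univ.filter fun i => p ≤ (c i).val + y ∧ (c i).val + 2 ≤ p).card +
        (Finset.univ.filter fun i => p = (c i).val + y).card + 1 ≤
        (Finset.univ.filter fun i => 1 ≤ (c i).val ∧ (c i).val < y).card +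
          6 * ∑ l ∈ pencil L x, k l) := by
  have hs : ∀ l : L, ∃ k : ℕ, l ∈ pencil L x → ∑ z ∈ others x l, (c z).val + 1 = p * (1 + k) := by
    intro l
    by_cases hl : x ∈ l
    · obtain ⟨k, hk⟩ := exists_sum_val_add_one (sum_others_of_eq_one hx hl (hc l))
      exact ⟨k, fun _ => hk⟩
    · exact ⟨0, fun h => absurd (Finset.mem_filter.1 h).2 hl⟩
  choose k hk using hs
  have hp := (Fact.out : p.Prime).two_le
  have hx1 : (c x).val = 1 := by
    have : Fact (1 < p) := ⟨hp⟩
    rw [hx, ZMod.val_one]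
  refine ⟨k, hk, ?_, ?_, fun y hy hyp => ?_, fun y hy hyp hne => ?_⟩
  · have h1 : ∑ l ∈ pencil L x, (∑ z ∈ others x l, (c z).val + 1) =
        ∑ l ∈ pencil L x, p * (1 + k l) := Finset.sum_congr rfl hk
    rw [← Finset.mul_sum, Finset.sum_add_distrib, Finset.sum_add_distrib, sum_pencil,
      Finset.sum_const, card_pencil, smul_eq_mul, mul_one] at h1
    rw [← h1, ← Finset.add_sum_erase _ _ (Finset.mem_univ x), hx1]
    ring
  · have h1 := Finset.sum_le_sum fun l hl => two_add_le_card (hk l hl)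
    rw [Finset.sum_add_distrib, Finset.sum_add_distrib, sum_pencil_card, sum_pencil_card,
      Finset.sum_const, card_pencil, smul_eq_mul,
      card_filter_erase (Q := fun i => c i = -1)] at h1
    · have h2 := card_filter_erase_add_one (Q := fun i => c i ≠ 0) (x := x) (by simp [hx])
      have h3 : hammingNorm c = (Finset.univ.filter fun i => c i ≠ 0).card := by
        unfold hammingNorm
        congr
      rw [h3, cnt]
      omega
    · intro h
      have := val_eq_pred_iff.2 h
      omega
  · have h1 := Finset.sum_le_sum fun l hl => card_neg_le_card_pos hyp (hk l hl)
    rw [Finset.sum_add_distrib, sum_pencil_card, sum_pencil_card, ← Finset.mul_sum,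
      card_filter_erase] at h1
    · have h2 := card_filter_erase_add_one (Q := fun i => 1 ≤ (c i).val ∧ (c i).val < y) (x := x)
        (by omega)
      omega
    · omega
  · have h1 := Finset.sum_le_sum fun l hl =>
      card_neg_add_le_card_pos hy hyp (hk l hl) fun j _ => hne j
    rw [Finset.sum_add_distrib, Finset.sum_add_distrib, sum_pencil_card, sum_pencil_card,
      sum_pencil_card, ← Finset.mul_sum, card_filter_erase, card_filter_erase] at h1
    · have h2 := card_filter_erase_add_one (Q := fun i => 1 ≤ (c i).val ∧ (c i).val < y) (x := x)
        (by omega)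
      omega
    · omega
    · omega

end Codeword

/-! ### The weight formula and comparison of multiplicities -/

section Weight

variable {P : Type*} [Fintype P] {p : ℕ}

theorem card_filter_eq_add {A B C : P → Prop} [DecidablePred A] [DecidablePred B] [DecidablePred C]
    (h : ∀ i, A i ↔ B i ∨ C i) (h' : ∀ i, B i → ¬ C i) :
    (Finset.univ.filter A).card = (Finset.univ.filter B).card + (Finset.univ.filter C).card := by
  rw [← Finset.card_union_of_disjoint (Finset.disjoint_filter.2 fun i _ => h' i),
    ← Finset.filter_or]
  congr 1
  ext i
  simp [h]

theorem eq_natCast_iff [NeZero p] {y : ℕ} (hy : y < p) {a : ZMod p} : a = y ↔ a.val = y := by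
  conv_rhs => rw [← ZMod.val_natCast_of_lt hy]
  exact (ZMod.val_injective p).eq_iff.symm

theorem eq_neg_natCast_iff [NeZero p] {y : ℕ} (hy0 : 0 < y) (hy : y < p) {a : ZMod p} :
    a = -y ↔ a.val + y = p := by
  have h : (-y : ZMod p) = ((p - y : ℕ) : ZMod p) := by
    rw [Nat.cast_sub hy.le, ZMod.natCast_self, zero_sub]
  rw [h, eq_natCast_iff (by omega)]
  omega

theorem cnt_neg (c : P → ZMod p) (a : ZMod p) : cnt (-c) a = cnt c (-a) := by
  unfold cnt
  simp only [Pi.neg_apply, neg_eq_iff_eq_neg]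

theorem hammingNorm_neg (c : P → ZMod p) : hammingNorm (-c) = hammingNorm c := by
  unfold hammingNorm
  simp

theorem sum_neg_val [NeZero p] (c : P → ZMod p) :
    ∑ z, ((-c) z).val + ∑ z, (c z).val = p * hammingNorm c := by
  rw [hammingNorm, mul_comm, ← smul_eq_mul, ← Finset.sum_const, Finset.sum_filter,
    ← Finset.sum_add_distrib]
  refine Finset.sum_congr rfl fun z _ => ?_
  have := ZMod.val_lt (c z)
  rw [Pi.neg_apply, ZMod.neg_val]
  by_cases h : c z = 0 <;> simp [h]
  omega

/-- The number of coordinates of a vector that are equal to plus or minus a given value. -/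
noncomputable def cntAbs (c : P → ZMod p) (a : ZMod p) : ℕ := cnt c a + cnt c (-a)

theorem cnt_pos_iff {c : P → ZMod p} {a : ZMod p} : 0 < cnt c a ↔ ∃ x, c x = a := by
  simp [cnt, Finset.card_pos, Finset.Nonempty]

variable [Fact p.Prime]

/-- `pencil_bounds` is used at a point of value 1 for c and at a point of value -1 for -c. On the
support the lifts of c and -c add up to p, so the two total sums determine the weight. -/
theorem weight_eq_of_eq_one (L : Type*) [Membership P L] [ProjectivePlane P L] [Fintype L]
    (hq : ProjectivePlane.order P L = p ^ 2) (hp3 : 3 ≤ p)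
    {c : P → ZMod p} (hc : ∀ l : L, ∑ z with z ∈ l, c z = 0) {x : P} (hx : c x = 1)
    (hw : hammingNorm c + 2 * p ≤ 2 * p ^ 2 + 4) :
    ∃ a a' : ℕ, hammingNorm c + 2 * p = 2 * p ^ 2 + 2 + (a + a') ∧
      ∑ z, (c z).val + p ^ 2 = p * (p ^ 2 + 1 + a) ∧
      2 * p ^ 2 + 3 + a ≤ hammingNorm c + cnt c (-1) ∧
      2 * p ^ 2 + 3 + a' ≤ hammingNorm c + cnt c 1 ∧
      (∀ y : ℕ, 2 ≤ y → 2 * y < p → cntAbs c y + 2 ≤ cntAbs c 1 + 3 * (a + a')) ∧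
      (∀ y : ℕ, 2 ≤ y → 2 * y < p → cntAbs c ((y - 1 : ℕ) : ZMod p) = 0 →
        2 * cntAbs c y + 2 ≤ cntAbs c 1 + 6 * (a + a')) := by
  obtain ⟨k, -, h1, h2, h3, h4⟩ := pencil_bounds hp3 L hc hx
  set a := ∑ l ∈ pencil L x, k l
  rw [hq] at h1 h2
  -- The value -1 must occur: `h2` bounds the weight plus its multiplicity below by 2p² + 3, and the
  -- weight alone is smaller.
  obtain ⟨x', hx'⟩ : ∃ x', c x' = -1 := by
    rw [← cnt_pos_iff]
    omega
  obtain ⟨k', -, h1', h2', h3', h4'⟩ := pencil_bounds hp3 L (c := -c) (fun l => by simp [hc l])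
    (x := x') (by simp [hx'])
  set a' := ∑ l ∈ pencil L x', k' l
  rw [hq] at h1' h2'
  rw [cnt_neg, neg_neg, hammingNorm_neg] at h2'
  have hneg : ∀ i, ((-c) i).val = if (c i).val = 0 then 0 else p - (c i).val := fun i => by
    rw [Pi.neg_apply, ZMod.neg_val]
    simp only [ZMod.val_eq_zero]
  have hlt : ∀ i, (c i).val < p := fun i => ZMod.val_lt _
  have hcnt : ∀ y : ℕ, y < p → cnt c y = (Finset.univ.filter fun i => (c i).val = y).card :=
    fun y hy => by simp only [cnt, eq_natCast_iff hy]
  have hcntneg : ∀ y : ℕ, 0 < y → y < p →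
      cnt c (-y) = (Finset.univ.filter fun i => (c i).val + y = p).card :=
    fun y hy0 hy => by simp only [cnt, eq_neg_natCast_iff hy0 hy]
  have hone := hcnt 1 (by omega)
  have hone' := hcntneg 1 one_pos (by omega)
  rw [Nat.cast_one] at hone hone'
  -- The ranges [-y, -2], [2, y], [1, y - 1] and [-(y - 1), -1] split into an inner range and one
  -- end value. The inner ranges cancel when the inequalities for c and -c are added, leaving only
  -- ±y and ±1.
  have key : ∀ y : ℕ, 2 ≤ y → 2 * y < p →
      (Finset.univ.filter fun i => p ≤ (c i).val + y ∧ (c i).val + 2 ≤ p).card =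
        (Finset.univ.filter fun i => p < (c i).val + y ∧ (c i).val + 2 ≤ p).card + cnt c (-y) ∧
      (Finset.univ.filter fun i => p ≤ ((-c) i).val + y ∧ ((-c) i).val + 2 ≤ p).card =
        (Finset.univ.filter fun i => 2 ≤ (c i).val ∧ (c i).val < y).card + cnt c y ∧
      (Finset.univ.filter fun i => 1 ≤ (c i).val ∧ (c i).val < y).card =
        (Finset.univ.filter fun i => 2 ≤ (c i).val ∧ (c i).val < y).card + cnt c 1 ∧
      (Finset.univ.filter fun i => 1 ≤ ((-c) i).val ∧ ((-c) i).val < y).card =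
        (Finset.univ.filter fun i => p < (c i).val + y ∧ (c i).val + 2 ≤ p).card + cnt c (-1) := by
    intro y hy hyp
    rw [hcnt y (by omega), hcntneg y (by omega) (by omega), hone, hone']
    refine ⟨card_filter_eq_add (fun i => ?_) fun i => ?_,
      card_filter_eq_add (fun i => ?_) fun i => ?_,
      card_filter_eq_add (fun i => ?_) fun i => ?_,
      card_filter_eq_add (fun i => ?_) fun i => ?_⟩ <;>
    have := hlt i <;>
    have := hneg i <;>
    split_ifs at this <;> omega
  refine ⟨a, a', ?_, h1, by omega, by omega, fun y hy hyp => ?_, fun y hy hyp h0 => ?_⟩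
  · have h5 := sum_neg_val c
    have hp0 : 0 < p := by omega
    refine Nat.eq_of_mul_eq_mul_left hp0 ?_
    nlinarith
  · have h6 := h3 y hy hyp
    have h7 := h3' y hy hyp
    have h8 := key y hy hyp
    unfold cntAbs
    omega
  · unfold cntAbs at h0
    rw [hcnt _ (by omega), hcntneg _ (by omega) (by omega)] at h0
    simp only [Nat.add_eq_zero_iff, Finset.card_eq_zero, Finset.filter_eq_empty_iff,
      Finset.mem_univ, true_implies] at h0
    have h6 := h4 y hy hyp fun z => by have := @h0.1 z; omega
    have h7 := h4' y hy hyp fun z => by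
      have := @h0.2 z; have := hlt z; have := hneg z
      split_ifs at this <;> omega
    have h8 := key y hy hyp
    have h9 : (Finset.univ.filter fun i => p = (c i).val + y).card = cnt c (-y) := by
      rw [hcntneg y (by omega) (by omega)]
      simp only [eq_comm]
    have h10 : (Finset.univ.filter fun i => p = ((-c) i).val + y).card = cnt c y := by
      rw [hcnt y (by omega)]
      congr 1
      ext i
      have := hlt i
      have := hneg i
      simp only [Finset.mem_filter, Finset.mem_univ, true_and]
      split_ifs at this <;> omega
    unfold cntAbs
    omega

end Weight

/-! ### Either one pair of values or all values -/

section Dichotomy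

variable {P : Type*} [Fintype P] {p : ℕ}

theorem cntAbs_neg (c : P → ZMod p) (a : ZMod p) : cntAbs c (-a) = cntAbs c a := by
  rw [cntAbs, cntAbs, neg_neg, add_comm]

variable [Fact p.Prime]

theorem cnt_smul (c : P → ZMod p) {a : ZMod p} (ha : a ≠ 0) (b : ZMod p) :
    cnt (a⁻¹ • c) b = cnt c (a * b) := by
  simp only [cnt, Pi.smul_apply, smul_eq_mul, inv_mul_eq_iff_eq_mul₀ ha]

theorem cntAbs_smul (c : P → ZMod p) {a : ZMod p} (ha : a ≠ 0) (b : ZMod p) :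
    cntAbs (a⁻¹ • c) b = cntAbs c (a * b) := by
  simp only [cntAbs, cnt_smul c ha, mul_neg]

theorem weight_eq_of_cnt_pos (L : Type*) [Membership P L] [ProjectivePlane P L] [Fintype L]
    (hq : ProjectivePlane.order P L = p ^ 2) (hp3 : 3 ≤ p)
    {c : P → ZMod p} (hc : ∀ l : L, ∑ z with z ∈ l, c z = 0) {α : ZMod p} (hα : α ≠ 0)
    (hx : 0 < cnt c α) (hw : hammingNorm c + 2 * p ≤ 2 * p ^ 2 + 4) :
    ∃ a a' : ℕ, hammingNorm c + 2 * p = 2 * p ^ 2 + 2 + (a + a') ∧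
      2 * p ^ 2 + 3 + a ≤ hammingNorm c + cnt c (-α) ∧
      2 * p ^ 2 + 3 + a' ≤ hammingNorm c + cnt c α ∧
      (∀ y : ℕ, 2 ≤ y → 2 * y < p → cntAbs c (α * y) + 2 ≤ cntAbs c α + 3 * (a + a')) ∧
      (∀ y : ℕ, 2 ≤ y → 2 * y < p → cntAbs c (α * ((y - 1 : ℕ) : ZMod p)) = 0 →
        2 * cntAbs c (α * y) + 2 ≤ cntAbs c α + 6 * (a + a')) := by
  obtain ⟨x, hx⟩ := cnt_pos_iff.1 hx
  have hn : hammingNorm (α⁻¹ • c) = hammingNorm c := by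
    unfold hammingNorm
    simp [hα]
  obtain ⟨a, a', h1, -, h2⟩ := weight_eq_of_eq_one L hq hp3 (c := α⁻¹ • c)
    (fun l => by simp [← Finset.mul_sum, hc l]) (x := x) (by simp [hx, hα]) (by rw [hn]; exact hw)
  simp only [cntAbs_smul c hα, cnt_smul c hα, hn, mul_one, mul_neg] at h1 h2
  exact ⟨a, a', h1, h2⟩

theorem exists_natCast_eq (hp3 : 3 ≤ p) {u : ZMod p} (hu : u ≠ 0) :
    ∃ y : ℕ, 1 ≤ y ∧ 2 * y < p ∧ (u = y ∨ u = -y) := by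
  have h := ZMod.val_lt u
  have h0 : u.val ≠ 0 := by rwa [ne_eq, ZMod.val_eq_zero]
  have hodd := (Fact.out : p.Prime).eq_two_or_odd
  by_cases h1 : 2 * u.val < p
  · exact ⟨u.val, by omega, h1, Or.inl (ZMod.natCast_zmod_val u).symm⟩
  · refine ⟨p - u.val, by omega, by omega, Or.inr ?_⟩
    rw [eq_neg_natCast_iff (by omega) (by omega)]
    omega

/-- Let e = a + a' ≤ 2, which is the same for all occurring α, and let N count ±values. Comparing
two different occurring pairs both ways gives e ≥ 1. If αy occurs but α(y - 1) does not, then N(αy)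
+ 4 ≤ 9e ≤ 18, while the weight bounds give N(α) ≥ 4p and comparison makes N(αy) too large for this.
So occurring multiples of α descend to α. Hence a second pair forces 2α to occur whenever α does. -/
theorem two_valued_or_full (L : Type*) [Membership P L] [ProjectivePlane P L] [Fintype L]
    (hq : ProjectivePlane.order P L = p ^ 2) (hp7 : 7 ≤ p)
    {c : P → ZMod p} (hc : ∀ l : L, ∑ z with z ∈ l, c z = 0) (hc0 : c ≠ 0)
    (hw : hammingNorm c + 2 * p ≤ 2 * p ^ 2 + 4) :
    (∃ α : ZMod p, α ≠ 0 ∧ 0 < cnt c α ∧ ∀ z, c z = 0 ∨ c z = α ∨ c z = -α) ∨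
      ((∀ α : ZMod p, α ≠ 0 → 0 < cnt c α) ∧ 2 * p ^ 2 + 3 ≤ hammingNorm c + 2 * p) := by
  have hp3 : 3 ≤ p := by omega
  have key := fun (α : ZMod p) (hα : α ≠ 0) (h : 0 < cnt c α) =>
    weight_eq_of_cnt_pos L hq hp3 hc hα h hw
  have hpos : ∀ α : ZMod p, α ≠ 0 → 0 < cntAbs c α → 0 < cnt c α := by
    intro α hα h
    by_contra h0
    have h1 : 0 < cnt c (-α) := by unfold cntAbs at h; omega
    obtain ⟨a, a', -, h2, -⟩ := key (-α) (neg_ne_zero.2 hα) h1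
    rw [neg_neg] at h2
    omega
  have hcomp : ∀ α : ZMod p, α ≠ 0 → 0 < cntAbs c α → ∀ β : ZMod p, β ≠ 0 → β ≠ α → β ≠ -α →
      ∃ y : ℕ, 2 ≤ y ∧ 2 * y < p ∧ cntAbs c (α * y) = cntAbs c β := by
    intro α hα h β hβ h1 h2
    obtain ⟨y, hy1, hyp, hy⟩ := exists_natCast_eq hp3 (div_ne_zero hβ hα)
    refine ⟨y, ?_, hyp, ?_⟩
    · by_contra hy2
      obtain rfl : y = 1 := by omega
      rw [Nat.cast_one, div_eq_iff hα, div_eq_iff hα, one_mul, neg_one_mul] at hy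
      tauto
    · obtain hy | hy := hy
      · rw [← hy, mul_div_cancel₀ _ hα]
      · rw [← neg_neg (y : ZMod p), ← hy, mul_neg, mul_div_cancel₀ _ hα, cntAbs_neg]
  have hdesc : ∀ α : ZMod p, α ≠ 0 → 0 < cntAbs c α → ∀ y : ℕ, 2 ≤ y → 2 * y < p →
      0 < cntAbs c (α * y) → 0 < cntAbs c (α * ((y - 1 : ℕ) : ZMod p)) := by
    intro α hα h y hy hyp hyα
    by_contra h0
    obtain ⟨a, a', h1, h2, h3, h4, h5⟩ := key α hα (hpos α hα h)
    have h6 := h5 y hy hyp (by omega)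
    have hy0 : (y : ZMod p) ≠ 0 := by
      rw [ne_eq, ZMod.natCast_eq_zero_iff]
      exact Nat.not_dvd_of_pos_of_lt (by omega) (by omega)
    have hαy := mul_ne_zero hα hy0
    obtain ⟨b, b', h7, -, -, h8, -⟩ := key (α * y) hαy (hpos _ hαy hyα)
    obtain ⟨z, hz, hzp, hzα⟩ := hcomp (α * y) hαy hyα α hα
      (fun h => by
        have : ((1 : ℕ) : ZMod p) = (y : ℕ) := by
          rw [Nat.cast_one]
          exact mul_left_cancel₀ hα (by rw [← h, mul_one])
        rw [eq_natCast_iff (by omega), ZMod.val_natCast_of_lt (by omega)] at this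
        omega)
      (fun h => by
        have : ((1 : ℕ) : ZMod p) = -(y : ℕ) := by
          rw [Nat.cast_one]
          refine mul_left_cancel₀ hα ?_
          rw [mul_one, mul_neg]
          exact h
        rw [eq_neg_natCast_iff (by omega) (by omega), ZMod.val_natCast_of_lt (by omega)] at this
        omega)
    have h9 := h8 z hz hzp
    rw [hzα] at h9
    unfold cntAbs at *
    omega
  have hdesc' : ∀ α : ZMod p, α ≠ 0 → 0 < cntAbs c α → ∀ y : ℕ, 2 * y < p →
      0 < cntAbs c (α * y) → ∀ d < y, 0 < cntAbs c (α * ((y - d : ℕ) : ZMod p)) := by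
    intro α hα h y hyp hyα d
    induction d with
    | zero => exact fun _ => by simpa using hyα
    | succ d ih =>
      intro hd
      have := hdesc α hα h (y - d) (by omega) (by omega) (ih (by omega))
      rwa [Nat.sub_sub] at this
  obtain ⟨x, hx⟩ := Function.ne_iff.1 hc0
  have hα : 0 < cnt c (c x) := cnt_pos_iff.2 ⟨x, rfl⟩
  by_cases htwo : ∀ z, c z = 0 ∨ c z = c x ∨ c z = -c x
  · exact Or.inl ⟨c x, hx, hα, htwo⟩
  right
  push Not at htwo
  obtain ⟨z, hz0, hz1, hz2⟩ := htwo
  have hβ : 0 < cnt c (c z) := cnt_pos_iff.2 ⟨z, rfl⟩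
  have hdouble : ∀ α : ZMod p, α ≠ 0 → 0 < cntAbs c α → 0 < cntAbs c (α * 2) := by
    intro α hα0 h
    obtain ⟨β, hβ0, hβα, hβα', hβ⟩ : ∃ β : ZMod p, β ≠ 0 ∧ β ≠ α ∧ β ≠ -α ∧ 0 < cntAbs c β := by
      by_cases h1 : c x = α ∨ c x = -α
      · refine ⟨c z, hz0, ?_, ?_, by unfold cntAbs; omega⟩
        · rintro rfl
          obtain h1 | h1 := h1
          · exact hz1 h1.symm
          · exact hz2 (by rw [h1, neg_neg])
        · intro h2
          obtain h1 | h1 := h1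
          · exact hz2 (by rw [h2, h1])
          · exact hz1 (by rw [h2, h1])
      · push Not at h1
        exact ⟨c x, hx, h1.1, h1.2, by unfold cntAbs; omega⟩
    obtain ⟨y, hy, hyp, hyβ⟩ := hcomp α hα0 h β hβ0 hβα hβα'
    have := hdesc' α hα0 h y hyp (by omega) (y - 2) (by omega)
    rwa [Nat.sub_sub_self hy, Nat.cast_ofNat] at this
  constructor
  · have hodd := (Fact.out : p.Prime).eq_two_or_odd
    have h2 : (2 : ZMod p) ≠ 0 := by
      rw [← Nat.cast_ofNat, ne_eq, ZMod.natCast_eq_zero_iff]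
      exact Nat.not_dvd_of_pos_of_lt (by omega) (by omega)
    have hα2 := mul_ne_zero hx h2
    have hN : 0 < cntAbs c (c x) := by unfold cntAbs; omega
    -- Relative to 2α the value -α is the largest multiple in the range 2y < p, so descending from
    -- it reaches every value up to sign.
    have hh : c x * 2 * (((p - 1) / 2 : ℕ) : ZMod p) = -c x := by
      have h3 : (2 : ZMod p) * (((p - 1) / 2 : ℕ) : ZMod p) = -1 := by
        rw [← Nat.cast_ofNat, ← Nat.cast_mul, Nat.mul_div_cancel' (by omega),
          Nat.cast_sub (by omega), ZMod.natCast_self, Nat.cast_one, zero_sub]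
      rw [mul_assoc, h3, mul_neg_one]
    intro γ hγ
    obtain ⟨y, hy1, hyp, hy⟩ := exists_natCast_eq hp3 (div_ne_zero hγ hα2)
    have h4 := hdesc' (c x * 2) hα2 (hdouble _ hx hN) ((p - 1) / 2) (by omega)
      (by rw [hh, cntAbs_neg]; exact hN) ((p - 1) / 2 - y) (by omega)
    rw [Nat.sub_sub_self (by omega)] at h4
    refine hpos γ hγ ?_
    obtain hy | hy := hy
    · rwa [← hy, mul_div_cancel₀ _ hα2] at h4
    · rwa [← neg_neg (y : ZMod p), ← hy, mul_neg, mul_div_cancel₀ _ hα2, cntAbs_neg] at h4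
  · obtain ⟨a, a', h1, -, -, h2, -⟩ := key (c x) hx hα
    obtain ⟨b, b', h3, -, -, h4, -⟩ := key (c z) hz0 hβ
    obtain ⟨y, hy, hyp, hyα⟩ := hcomp (c x) hx (by unfold cntAbs; omega) (c z) hz0 hz1 hz2
    obtain ⟨y', hy', hyp', hyβ⟩ := hcomp (c z) hz0 (by unfold cntAbs; omega) (c x) hx
      (Ne.symm hz1) (fun h => hz2 (by rw [h, neg_neg]))
    have h5 := h2 y hy hyp
    have h6 := h4 y' hy' hyp'
    omega

end Dichotomy

/-! ### Double counting with a pair weight -/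

section Quadratic

variable {P : Type*} {p : ℕ}

/-- The number of elements of a finite set at which a vector takes a given value. -/
noncomputable def mult (c : P → ZMod p) (s : Finset P) (v : ZMod p) : ℤ :=
  ((s.filter fun z => c z = v).card : ℤ)

theorem mult_nonneg (c : P → ZMod p) (s : Finset P) (v : ZMod p) : 0 ≤ mult c s v :=
  Int.natCast_nonneg _

variable [Fact p.Prime]

theorem sum_eq_sum_mult (c : P → ZMod p) (s : Finset P) (g : ZMod p → ℤ) :
    ∑ z ∈ s, g (c z) = ∑ v, mult c s v * g v := by
  rw [← Finset.sum_fiberwise s c]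
  refine Finset.sum_congr rfl fun v _ => ?_
  rw [Finset.sum_congr rfl (g := fun _ => g v)
    (fun z hz => by rw [(Finset.mem_filter.1 hz).2]), Finset.sum_const, nsmul_eq_mul, mult]

theorem sum_sum_eq_sum_mult (c : P → ZMod p) (s : Finset P) (A : ZMod p → ZMod p → ℤ) :
    ∑ x ∈ s, ∑ y ∈ s, A (c x) (c y) = ∑ u, ∑ v, mult c s u * mult c s v * A u v := by
  simp only [sum_eq_sum_mult c s (A _), sum_eq_sum_mult c s (fun u => ∑ v, mult c s v * A u v),
    Finset.mul_sum, mul_assoc]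

theorem card_eq_sum_mult (c : P → ZMod p) (s : Finset P) : (s.card : ℤ) = ∑ v, mult c s v := by
  simpa using sum_eq_sum_mult c s fun _ => 1

theorem sum_eq_sum_mult_cast (c : P → ZMod p) (s : Finset P) :
    ∑ z ∈ s, c z = ∑ v, (mult c s v : ZMod p) * v := by
  rw [← Finset.sum_fiberwise s c]
  refine Finset.sum_congr rfl fun v _ => ?_
  rw [Finset.sum_congr rfl (g := fun _ => v)
    (fun z hz => (Finset.mem_filter.1 hz).2), Finset.sum_const, nsmul_eq_mul, mult,
    Int.cast_natCast]

theorem mult_zero {c : P → ZMod p} {s : Finset P} (h : ∀ z ∈ s, c z ≠ 0) : mult c s 0 = 0 := by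
  simp only [mult, Nat.cast_eq_zero, Finset.card_eq_zero, Finset.filter_eq_empty_iff]
  exact h

variable [Fintype P] {L : Type*} [Membership P L] [ProjectivePlane P L] [Fintype L]

/-- The hypothesis is summed over all lines, for the support points on each. Two distinct points
share one line, whereas a diagonal pair is counted on all q + 1 lines, that is q extra times with
weight d. -/
theorem quadratic_bound (L : Type*) [Membership P L] [ProjectivePlane P L] [Fintype L]
    {c : P → ZMod p} (hc : ∀ l : L, ∑ z with z ∈ l, c z = 0)
    {A : ZMod p → ZMod p → ℤ} {B d : ℤ} (hd : ∀ v, v ≠ 0 → A v v = d)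
    (h : ∀ s : Finset P, (∀ z ∈ s, c z ≠ 0) → ∑ z ∈ s, c z = 0 →
      B * s.card ≤ ∑ x ∈ s, ∑ y ∈ s, A (c x) (c y)) {S : Finset P}
    (hS : S = Finset.univ.filter fun z => c z ≠ 0) :
    B * ((ProjectivePlane.order P L + 1) * S.card) ≤
      ∑ x ∈ S, ∑ y ∈ S, A (c x) (c y) + ProjectivePlane.order P L * d * S.card := by
  have hmem : ∀ z, z ∈ S ↔ c z ≠ 0 := by simp [hS]
  have h1 : ∀ l : L, B * (S.filter fun z => z ∈ l).card ≤
      ∑ x ∈ S.filter fun z => z ∈ l, ∑ y ∈ S.filter fun z => z ∈ l, A (c x) (c y) := by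
    intro l
    refine h _ (fun z hz => (hmem z).1 (Finset.mem_filter.1 hz).1) ?_
    rw [← hc l]
    refine Finset.sum_subset (fun z hz => by simp [(Finset.mem_filter.1 hz).2]) fun z hz hz' => ?_
    by_contra h0
    exact hz' (Finset.mem_filter.2 ⟨(hmem z).2 h0, (Finset.mem_filter.1 hz).2⟩)
  have hswap : ∀ (g : P → L → ℤ), ∑ l : L, ∑ x ∈ S.filter (fun z => z ∈ l), g x l =
      ∑ x ∈ S, ∑ l ∈ pencil L x, g x l := by
    intro g
    refine Finset.sum_comm' fun l x => ?_
    simp [pencil, and_comm]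
  have h2 := Finset.sum_le_sum fun l (_ : l ∈ Finset.univ) => h1 l
  rw [← Finset.mul_sum] at h2
  have h3 : ∑ l : L, ((S.filter fun z => z ∈ l).card : ℤ) =
      (ProjectivePlane.order P L + 1) * S.card := by
    have := hswap fun _ _ => 1
    simp only [Finset.sum_const, nsmul_eq_mul, mul_one, card_pencil] at this
    rw [this]
    push_cast
    ring
  rw [h3, hswap] at h2
  refine h2.trans (le_of_eq ?_)
  have h4 : ∀ x ∈ S, ∑ l ∈ pencil L x, ∑ y ∈ S.filter (fun z => z ∈ l), A (c x) (c y) =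
      ∑ y ∈ S, A (c x) (c y) + ProjectivePlane.order P L * d := by
    intro x hx
    have h5 : ∀ l ∈ pencil L x, ∑ y ∈ S.filter (fun z => z ∈ l), A (c x) (c y) =
        d + ∑ y ∈ others x l, if y ∈ S then A (c x) (c y) else 0 := by
      intro l hl
      have hl' : x ∈ l := (Finset.mem_filter.1 hl).2
      rw [← Finset.add_sum_erase _ _ (Finset.mem_filter.2 ⟨hx, hl'⟩), hd _ ((hmem x).1 hx),
        ← Finset.sum_filter]
      congr 2
      ext z
      simp only [others, Finset.mem_erase, Finset.mem_filter, Finset.mem_univ, true_and]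
      tauto
    rw [Finset.sum_congr rfl h5, Finset.sum_add_distrib, sum_pencil, Finset.sum_const, card_pencil,
      ← Finset.sum_filter, ← Finset.add_sum_erase _ _ hx, hd _ ((hmem x).1 hx), nsmul_eq_mul]
    have h6 : (Finset.univ.erase x).filter (fun z => z ∈ S) = S.erase x := by
      ext z
      simp [Finset.mem_erase]
    rw [h6]
    push_cast
    ring
  rw [Finset.sum_congr rfl h4, Finset.sum_add_distrib, Finset.sum_const, nsmul_eq_mul]
  ring

/-- The pair weight that favours opposite and equal values and penalizes ratio `-2`. -/
def pairWeight (u v : ZMod p) : ℤ :=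
  1 + (if v = -u then 1 else 0) + 2 * (if v = u then 1 else 0) - 2 * (if v = -2 * u then 1 else 0)

theorem sum_sum_pairWeight (m : ZMod p → ℤ) :
    ∑ u, ∑ v, m u * m v * pairWeight u v =
      (∑ v, m v) ^ 2 + ∑ v, m v * m (-v) + 2 * ∑ v, m v ^ 2 - 2 * ∑ v, m v * m (-2 * v) := by
  simp only [pairWeight, mul_sub, mul_add, Finset.sum_add_distrib, Finset.sum_sub_distrib, mul_one,
    ← Finset.mul_sum, mul_ite, mul_zero, Finset.sum_ite_eq',
    Finset.mem_univ, if_true]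
  rw [sq, Finset.sum_mul_sum]
  simp only [sq, Finset.mul_sum, Finset.sum_mul, mul_comm (2 : ℤ)]

theorem sum_mul_neg_two_le (h2 : (2 : ZMod p) ≠ 0) (m : ZMod p → ℤ) :
    ∑ v, m v * m (-2 * v) ≤ ∑ v, m v ^ 2 := by
  have h1 : ∑ v, m (-2 * v) ^ 2 = ∑ v, m v ^ 2 :=
    Fintype.sum_bijective (fun v : ZMod p => -2 * v)
      (mulLeft_bijective₀ _ (neg_ne_zero.2 h2)) _ _ fun _ => rfl
  have h3 : ∑ v, 2 * (m v * m (-2 * v)) ≤ ∑ v, (m v ^ 2 + m (-2 * v) ^ 2) :=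
    Finset.sum_le_sum fun v _ => by nlinarith [sq_nonneg (m v - m (-2 * v))]
  rw [Finset.sum_add_distrib, h1, ← Finset.mul_sum] at h3
  linarith

end Quadratic

/-! ### Forbidden configurations of ratio -2 -/

section PairWeight

variable {F : Type*} [Field F]

/-- Around a triangle the ratios multiply to 1, so -2 or -8 would equal 1, that is 3 = 0 or 9 = 0.
-/
theorem ratio_triangle (h2 : (2 : F) ≠ 0) (h3 : (3 : F) ≠ 0) {a b c : F}
    (hc : c ≠ 0) : ¬ ((b = -2 * a ∨ a = -2 * b) ∧ (c = -2 * b ∨ b = -2 * c) ∧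
      (c = -2 * a ∨ a = -2 * c)) := by
  have h9 : (9 : F) ≠ 0 := by
    have := mul_ne_zero h3 h3
    norm_num at this ⊢
    exact this
  have h6 : (6 : F) ≠ 0 := by
    have := mul_ne_zero h2 h3
    norm_num at this ⊢
    exact this
  grind

/-- The only neighbours of a are -2a and -a/2. -/
theorem ratio_star (h2 : (2 : F) ≠ 0) {a b c d : F}
    (hbc : b ≠ c) (hbd : b ≠ d) (hcd : c ≠ d) : ¬ ((b = -2 * a ∨ a = -2 * b) ∧
      (c = -2 * a ∨ a = -2 * c) ∧ (d = -2 * a ∨ a = -2 * d)) := by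
  grind

/-- A path that does not turn back is t, -2t, 4t, -8t or its reverse, and these sum to -5t. This is
where the characteristic must differ from 5. -/
theorem ratio_path (h2 : (2 : F) ≠ 0) (h5 : (5 : F) ≠ 0) {a b c d : F} (hd : d ≠ 0)
    (hac : a ≠ c) (hbd : b ≠ d) (hs : a + b + c + d = 0) : ¬ ((b = -2 * a ∨ a = -2 * b) ∧
      (c = -2 * b ∨ b = -2 * c) ∧ (d = -2 * c ∨ c = -2 * d)) := by
  grind

end PairWeight

/-! ### The pair weight on zero-sum configurations -/

section LineInequality

variable {p : ℕ} [Fact p.Prime]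

theorem ofNat_ne_zero_of_lt {n : ℕ} (h0 : 0 < n) (hn : n < p) : (n : ZMod p) ≠ 0 := by
  rw [ne_eq, ZMod.natCast_eq_zero_iff]
  exact Nat.not_dvd_of_pos_of_lt h0 hn

theorem two_ne_zero_of_lt (hp : 2 < p) : (2 : ZMod p) ≠ 0 := by
  exact_mod_cast ofNat_ne_zero_of_lt (n := 2) two_pos hp

theorem three_ne_zero_of_lt (hp : 3 < p) : (3 : ZMod p) ≠ 0 := by
  exact_mod_cast ofNat_ne_zero_of_lt (n := 3) three_pos hp

/-- The pair weight in both orders. -/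
def pairWeight₂ (u v : ZMod p) : ℤ := pairWeight u v + pairWeight v u

theorem pairWeight₂_self (hp : 3 < p) {u : ZMod p} (hu : u ≠ 0) : pairWeight₂ u u = 6 := by
  have h2 : (2 : ZMod p) ≠ 0 := two_ne_zero_of_lt (by omega)
  have h3 : (3 : ZMod p) ≠ 0 := three_ne_zero_of_lt hp
  have h4 : u ≠ -u := by grind
  have h5 : u ≠ -(2 * u) := by grind
  simp [pairWeight₂, pairWeight, h4, h5]

theorem pairWeight_self (hp : 3 < p) {u : ZMod p} (hu : u ≠ 0) : pairWeight u u = 3 := by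
  have := pairWeight₂_self hp hu
  unfold pairWeight₂ at this
  omega

theorem pairWeight₂_neg (hp : 3 < p) {u v : ZMod p} (hu : u ≠ 0) (h : v = -u) :
    4 ≤ pairWeight₂ u v := by
  have h2 : (2 : ZMod p) ≠ 0 := two_ne_zero_of_lt (by omega)
  have h1 : u = -v := by rw [h, neg_neg]
  have h4 : v ≠ -2 * u := by grind
  have h5 : u ≠ -2 * v := by grind
  unfold pairWeight₂ pairWeight
  rw [if_pos h, if_pos h1, if_neg h4, if_neg h5]
  split_ifs <;> norm_num

theorem two_le_pairWeight₂ {u v : ZMod p} (h : ¬ (v = -2 * u ∨ u = -2 * v)) :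
    2 ≤ pairWeight₂ u v := by
  push Not at h
  unfold pairWeight₂ pairWeight
  rw [if_neg h.1, if_neg h.2]
  split_ifs <;> norm_num

theorem pairWeight₂_nonneg (hp : 3 < p) {u v : ZMod p} (hu : u ≠ 0) : 0 ≤ pairWeight₂ u v := by
  have h2 : (2 : ZMod p) ≠ 0 := two_ne_zero_of_lt (by omega)
  have h3 : (3 : ZMod p) ≠ 0 := three_ne_zero_of_lt hp
  have h4 : ¬ (v = -2 * u ∧ u = -2 * v) := by grind
  unfold pairWeight₂ pairWeight
  split_ifs <;> first | omega | tauto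

theorem pairWeight₂_comm (u v : ZMod p) : pairWeight₂ u v = pairWeight₂ v u := add_comm _ _

/-- In a zero-sum triple a ratio -2 forces two equal values, and an equal pair alone contributes 6.
Without equal values no pair is penalized. -/
theorem sum_three_pairWeight₂ (hp : 3 < p) {a b c : ZMod p} (ha : a ≠ 0) (hb : b ≠ 0) (hc : c ≠ 0)
    (hs : a + b + c = 0) : 6 ≤ pairWeight₂ a b + pairWeight₂ a c + pairWeight₂ b c := by
  have h1 := pairWeight₂_nonneg hp (v := b) ha
  have h2 := pairWeight₂_nonneg hp (v := c) ha
  have h3 := pairWeight₂_nonneg hp (v := c) hb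
  by_cases hab : a = b
  · subst hab
    rw [pairWeight₂_self hp ha]
    omega
  by_cases hac : a = c
  · subst hac
    rw [pairWeight₂_self hp ha]
    omega
  by_cases hbc : b = c
  · subst hbc
    rw [pairWeight₂_self hp hb]
    omega
  have h4 := two_le_pairWeight₂ (u := a) (v := b) (by grind)
  have h5 := two_le_pairWeight₂ (u := a) (v := c) (by grind)
  have h6 := two_le_pairWeight₂ (u := b) (v := c) (by grind)
  omega

theorem sum_four_pairWeight₂_of_eq (hp : 3 < p) {a b c d : ZMod p} (ha : a ≠ 0) (hb : b ≠ 0)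
    (hc : c ≠ 0) (hd : d ≠ 0) (hab : a = b) :
    8 ≤ pairWeight₂ a b + pairWeight₂ a c + pairWeight₂ a d + pairWeight₂ b c +
      pairWeight₂ b d + pairWeight₂ c d := by
  have h2 : (2 : ZMod p) ≠ 0 := two_ne_zero_of_lt (by omega)
  have h3 : (3 : ZMod p) ≠ 0 := three_ne_zero_of_lt hp
  have t1 := pairWeight₂_nonneg hp (v := c) ha
  have t2 := pairWeight₂_nonneg hp (v := d) ha
  have t3 := pairWeight₂_nonneg hp (v := c) hb
  have t4 := pairWeight₂_nonneg hp (v := d) hb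
  have t5 := pairWeight₂_nonneg hp (v := d) hc
  have h6 : pairWeight₂ a b = 6 := by rw [← hab, pairWeight₂_self hp ha]
  have h7 := ratio_triangle h2 h3 (a := a) (b := c) hd
  by_cases r1 : c = -2 * a ∨ a = -2 * c
  · by_cases r2 : d = -2 * c ∨ c = -2 * d
    · have := two_le_pairWeight₂ (u := a) (v := d) (by tauto)
      omega
    · have := two_le_pairWeight₂ r2
      omega
  · have := two_le_pairWeight₂ r1
    omega

/-- For distinct values, a total below 8 needs three penalized pairs among the six. Three edges on
four vertices contain a triangle, a star or a path, all of which are excluded. -/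
theorem sum_four_pairWeight₂ (hp : 5 < p) {a b c d : ZMod p} (ha : a ≠ 0) (hb : b ≠ 0)
    (hc : c ≠ 0) (hd : d ≠ 0) (hs : a + b + c + d = 0) :
    8 ≤ pairWeight₂ a b + pairWeight₂ a c + pairWeight₂ a d + pairWeight₂ b c +
      pairWeight₂ b d + pairWeight₂ c d := by
  have hp3 : 3 < p := by omega
  have h2 : (2 : ZMod p) ≠ 0 := two_ne_zero_of_lt (by omega)
  have h3 : (3 : ZMod p) ≠ 0 := three_ne_zero_of_lt hp3
  have h5 : (5 : ZMod p) ≠ 0 := by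
    exact_mod_cast ofNat_ne_zero_of_lt (n := 5) (by omega) hp
  by_cases hab : a = b
  · exact sum_four_pairWeight₂_of_eq hp3 ha hb hc hd hab
  by_cases hac : a = c
  · have := sum_four_pairWeight₂_of_eq hp3 ha hc hb hd hac
    rw [pairWeight₂_comm c b] at this
    omega
  by_cases had : a = d
  · have := sum_four_pairWeight₂_of_eq hp3 ha hd hb hc had
    rw [pairWeight₂_comm d b, pairWeight₂_comm d c] at this
    omega
  by_cases hbc : b = c
  · have := sum_four_pairWeight₂_of_eq hp3 hb hc ha hd hbc
    rw [pairWeight₂_comm b a, pairWeight₂_comm c a] at this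
    omega
  by_cases hbd : b = d
  · have := sum_four_pairWeight₂_of_eq hp3 hb hd ha hc hbd
    rw [pairWeight₂_comm b a, pairWeight₂_comm d a, pairWeight₂_comm d c] at this
    omega
  by_cases hcd : c = d
  · have := sum_four_pairWeight₂_of_eq hp3 hc hd ha hb hcd
    rw [pairWeight₂_comm c a, pairWeight₂_comm d a, pairWeight₂_comm c b,
      pairWeight₂_comm d b] at this
    omega
  have key : ∀ u v : ZMod p, u ≠ 0 → 0 ≤ pairWeight₂ u v ∧
      (2 ≤ pairWeight₂ u v ∨ (v = -2 * u ∨ u = -2 * v)) := fun u v hu =>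
    ⟨pairWeight₂_nonneg hp3 hu, by
      by_cases h : v = -2 * u ∨ u = -2 * v
      · exact Or.inr h
      · exact Or.inl (two_le_pairWeight₂ h)⟩
  obtain ⟨nab, tab | rab⟩ := key a b ha <;>
  obtain ⟨nac, tac | rac⟩ := key a c ha <;>
  obtain ⟨nad, tad | rad⟩ := key a d ha <;>
  obtain ⟨nbc, tbc | rbc⟩ := key b c hb <;>
  obtain ⟨nbd, tbd | rbd⟩ := key b d hb <;>
  obtain ⟨ncd, tcd | rcd⟩ := key c d hc <;>
  first
  | omega
  | exfalso
    first
    | exact ratio_star h2 hbc hbd hcd ⟨rab, rac, rad⟩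
    | exact ratio_star h2 hac had hcd ⟨rab.symm, rbc, rbd⟩
    | exact ratio_star h2 hab had hbd ⟨rac.symm, rbc.symm, rcd⟩
    | exact ratio_star h2 hab hac hbc ⟨rad.symm, rbd.symm, rcd.symm⟩
    | exact ratio_triangle h2 h3 hc ⟨rab, rbc, rac⟩
    | exact ratio_triangle h2 h3 hd ⟨rab, rbd, rad⟩
    | exact ratio_triangle h2 h3 hd ⟨rac, rcd, rad⟩
    | exact ratio_triangle h2 h3 hd ⟨rbc, rcd, rbd⟩
    | exact ratio_path h2 h5 hd hac hbd (by linear_combination hs)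
        ⟨rab, rbc, rcd⟩
    | exact ratio_path h2 h5 hc had hbc (by linear_combination hs)
        ⟨rab, rbd, rcd.symm⟩
    | exact ratio_path h2 h5 hd hab hcd (by linear_combination hs)
        ⟨rac, rbc.symm, rbd⟩
    | exact ratio_path h2 h5 hb had (Ne.symm hbc) (by linear_combination hs)
        ⟨rac, rcd, rbd.symm⟩
    | exact ratio_path h2 h5 hc hab (Ne.symm hcd) (by linear_combination hs)
        ⟨rad, rbd.symm, rbc⟩
    | exact ratio_path h2 h5 hb hac (Ne.symm hbd) (by linear_combination hs)
        ⟨rad, rcd.symm, rbc.symm⟩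
    | exact ratio_path h2 h5 hd hbc had (by linear_combination hs)
        ⟨rab.symm, rac, rcd⟩
    | exact ratio_path h2 h5 hc hbd hac (by linear_combination hs)
        ⟨rab.symm, rad, rcd.symm⟩
    | exact ratio_path h2 h5 hd (Ne.symm hab) hcd (by linear_combination hs)
        ⟨rbc, rac.symm, rad⟩
    | exact ratio_path h2 h5 hc (Ne.symm hab) (Ne.symm hcd) (by linear_combination hs)
        ⟨rbd, rad.symm, rac⟩
    | exact ratio_path h2 h5 hd (Ne.symm hbc) had (by linear_combination hs)
        ⟨rac.symm, rab, rbd⟩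
    | exact ratio_path h2 h5 hd (Ne.symm hac) hbd (by linear_combination hs)
        ⟨rbc.symm, rab.symm, rad⟩

/-- From 5 points on, the constant part of the weight gives the square of the size and the equal
pairs outweigh the penalties. For fewer points the diagonal gives 3 per point, so the off-diagonal
pairs must supply 2 per point. -/
theorem pairWeight_line {P : Type*} (hp : 5 < p) (c : P → ZMod p) (s : Finset P)
    (h0 : ∀ z ∈ s, c z ≠ 0) (hs : ∑ z ∈ s, c z = 0) :
    5 * (s.card : ℤ) ≤ ∑ x ∈ s, ∑ y ∈ s, pairWeight (c x) (c y) := by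
  have hp3 : 3 < p := by omega
  obtain hk | hk := le_or_gt 5 s.card
  · rw [sum_sum_eq_sum_mult c s, sum_sum_pairWeight, ← card_eq_sum_mult]
    have h1 := sum_mul_neg_two_le (two_ne_zero_of_lt (by omega)) (mult c s)
    have h2 : 0 ≤ ∑ v, mult c s v * mult c s (-v) :=
      Finset.sum_nonneg fun v _ => mul_nonneg (mult_nonneg _ _ _) (mult_nonneg _ _ _)
    have h3 : (5 : ℤ) ≤ s.card := by exact_mod_cast hk
    nlinarith
  · obtain h | h | h | h | h : s.card = 0 ∨ s.card = 1 ∨ s.card = 2 ∨ s.card = 3 ∨ s.card = 4 := by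
      omega
    · simp [Finset.card_eq_zero.1 h]
    · obtain ⟨a, rfl⟩ := Finset.card_eq_one.1 h
      simp only [Finset.sum_singleton, Finset.mem_singleton, forall_eq] at hs h0
      exact absurd hs h0
    · obtain ⟨a, b, hab, rfl⟩ := Finset.card_eq_two.1 h
      simp only [Finset.sum_pair hab, Finset.mem_insert, Finset.mem_singleton, forall_eq_or_imp,
        forall_eq] at hs h0 ⊢
      have h1 := pairWeight₂_neg hp3 h0.1 (eq_neg_of_add_eq_zero_right hs)
      rw [pairWeight_self hp3 h0.1, pairWeight_self hp3 h0.2, h]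
      unfold pairWeight₂ at h1
      push_cast
      linarith
    · obtain ⟨a, b, d, hab, had, hbd, rfl⟩ := Finset.card_eq_three.1 h
      have hsum : ∀ {M : Type} [AddCommMonoid M] (f : P → M),
          ∑ x ∈ ({a, b, d} : Finset P), f x = f a + (f b + f d) := fun f => by
        rw [Finset.sum_insert (by simp [hab, had]), Finset.sum_pair hbd]
      simp only [hsum, Finset.mem_insert, Finset.mem_singleton, forall_eq_or_imp,
        forall_eq] at hs h0 ⊢
      have h1 := sum_three_pairWeight₂ hp3 h0.1 h0.2.1 h0.2.2 (by rw [add_assoc]; exact hs)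
      rw [pairWeight_self hp3 h0.1, pairWeight_self hp3 h0.2.1, pairWeight_self hp3 h0.2.2, h]
      unfold pairWeight₂ at h1
      push_cast
      linarith
    · obtain ⟨a, t, hat, rfl, ht⟩ := Finset.card_eq_succ.1 h
      obtain ⟨b, d, e, hbd, hbe, hde, rfl⟩ := Finset.card_eq_three.1 ht
      have hsum : ∀ {M : Type} [AddCommMonoid M] (f : P → M),
          ∑ x ∈ insert a ({b, d, e} : Finset P), f x = f a + (f b + (f d + f e)) := fun f => by
        rw [Finset.sum_insert hat, Finset.sum_insert (by simp [hbd, hbe]), Finset.sum_pair hde]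
      simp only [hsum, Finset.mem_insert, Finset.mem_singleton, forall_eq_or_imp,
        forall_eq] at hs h0 ⊢
      have h1 := sum_four_pairWeight₂ hp h0.1 h0.2.1 h0.2.2.1 h0.2.2.2
        (by rw [add_assoc, add_assoc]; exact hs)
      rw [pairWeight_self hp3 h0.1, pairWeight_self hp3 h0.2.1, pairWeight_self hp3 h0.2.2.1,
        pairWeight_self hp3 h0.2.2.2, h]
      unfold pairWeight₂ at h1
      push_cast
      linarith

end LineInequality

/-! ### All values occur, p ≥ 11 -/

section Full

variable {P : Type*} [Fintype P] {p : ℕ} [Fact p.Prime]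

theorem sum_mult_erase_zero {f : ZMod p → ℤ} (h : f 0 = 0) :
    ∑ v, f v = ∑ v ∈ Finset.univ.erase 0, f v := by
  rw [← Finset.add_sum_erase _ _ (Finset.mem_univ (0 : ZMod p)), h, zero_add]

theorem mult_support {c : P → ZMod p} {S : Finset P} (hS : S = Finset.univ.filter fun z => c z ≠ 0)
    {v : ZMod p} (hv : v ≠ 0) : mult c S v = cnt c v := by
  rw [mult, cnt, hS, Finset.filter_filter]
  congr 2
  ext z
  simp only [Finset.mem_filter, Finset.mem_univ, true_and]
  exact ⟨fun h => h.2, fun h => ⟨h ▸ hv, h⟩⟩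

theorem sum_erase_neg (f : ZMod p → ℤ) :
    ∑ v ∈ Finset.univ.erase (0 : ZMod p), f (-v) = ∑ v ∈ Finset.univ.erase 0, f v := by
  refine Finset.sum_bij (fun v _ => -v) ?_ ?_ ?_ ?_
  · intro v hv
    simpa using hv
  · intro v _ v' _ h
    exact neg_injective h
  · intro v hv
    exact ⟨-v, by simpa using hv, neg_neg v⟩
  · intro v _
    rfl

theorem sum_erase_mul {a : ZMod p} (ha : a ≠ 0) (f : ZMod p → ℤ) :
    ∑ v ∈ Finset.univ.erase (0 : ZMod p), f (a * v) = ∑ v ∈ Finset.univ.erase 0, f v := by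
  refine Finset.sum_bij (fun v _ => a * v) ?_ ?_ ?_ ?_
  · intro v hv
    simpa [ha] using hv
  · intro v _ v' _ h
    exact mul_left_cancel₀ ha h
  · intro v hv
    exact ⟨a⁻¹ * v, by simpa [ha] using hv, mul_inv_cancel_left₀ ha v⟩
  · intro v _
    rfl

/-- An upper bound for the quadratic form of a nearly constant function. -/
theorem quadratic_form_le (h2 : (2 : ZMod p) ≠ 0) {n : ZMod p → ℤ} {b : ℤ}
    (hn : ∀ v, v ≠ 0 → b ≤ n v) :
    ∑ v ∈ Finset.univ.erase (0 : ZMod p), (n v * n (-v) + 2 * n v ^ 2 - 2 * (n v * n (-2 * v))) ≤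
      ((p : ℤ) - 1) * b ^ 2 + 2 * b * ∑ v ∈ Finset.univ.erase (0 : ZMod p), (n v - b) +
        ∑ v ∈ Finset.univ.erase (0 : ZMod p), (n v - b + (n (-v) - b)) ^ 2 := by
  have hcard : ((Finset.univ.erase (0 : ZMod p)).card : ℤ) = (p : ℤ) - 1 := by
    rw [Finset.card_erase_of_mem (Finset.mem_univ _), Finset.card_univ, ZMod.card,
      Nat.cast_sub (Fact.out : p.Prime).one_le, Nat.cast_one]
  have e1 := sum_erase_neg (p := p) fun v => (n v - b) ^ 2
  have e2 := sum_erase_mul (p := p) (neg_ne_zero.2 h2) fun v => n v ^ 2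
  have e3 := sum_erase_mul (p := p) (neg_ne_zero.2 h2) fun v => (n v - b) ^ 2
  have e4 := sum_erase_neg (p := p) fun v => n v - b
  -- Reindexing by v ↦ -2v turns one of the two squares of n v into that of n (-2v), so a square of
  -- the difference appears. With n = b + r and r ≥ 0, that square is at most the sum of the two r².
  have h1 : ∀ v ∈ Finset.univ.erase (0 : ZMod p),
      n v * n (-v) + n v ^ 2 + n (-2 * v) ^ 2 - 2 * (n v * n (-2 * v)) ≤
        b ^ 2 + b * (n v - b) + b * (n (-v) - b) + (n v - b) * (n (-v) - b) +
          (n v - b) ^ 2 + (n (-2 * v) - b) ^ 2 := by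
    intro v hv
    have hv0 := Finset.ne_of_mem_erase hv
    have h3 := hn v hv0
    have h4 := hn (-2 * v) (mul_ne_zero (neg_ne_zero.2 h2) hv0)
    nlinarith [mul_nonneg (sub_nonneg.2 h3) (sub_nonneg.2 h4)]
  have h5 := Finset.sum_le_sum h1
  have h6 : ∑ v ∈ Finset.univ.erase (0 : ZMod p), (n v - b + (n (-v) - b)) ^ 2 =
      ∑ v ∈ Finset.univ.erase (0 : ZMod p), (n v - b) ^ 2 +
      ∑ v ∈ Finset.univ.erase (0 : ZMod p), (n (-v) - b) ^ 2 +
      2 * ∑ v ∈ Finset.univ.erase (0 : ZMod p), (n v - b) * (n (-v) - b) := by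
    rw [Finset.mul_sum, ← Finset.sum_add_distrib, ← Finset.sum_add_distrib]
    exact Finset.sum_congr rfl fun v _ => by ring
  have h7 : 0 ≤ ∑ v ∈ Finset.univ.erase (0 : ZMod p), (n v - b) * (n (-v) - b) :=
    Finset.sum_nonneg fun v hv => mul_nonneg (sub_nonneg.2 (hn v (Finset.ne_of_mem_erase hv)))
      (sub_nonneg.2 (hn _ (neg_ne_zero.2 (Finset.ne_of_mem_erase hv))))
  simp only [Finset.sum_add_distrib, Finset.sum_sub_distrib, ← Finset.mul_sum, Finset.sum_const,
    nsmul_eq_mul, hcard] at h5 h6 e1 e2 e3 e4 h7 ⊢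
  rw [e4] at h5
  linarith

theorem sum_sq_le_of_sum_eq {ι : Type*} {s : Finset ι} {f : ι → ℤ} {e X : ℤ}
    (hf : ∀ i ∈ s, e ≤ f i) (hX : ∑ i ∈ s, (f i - e) = X) :
    ∑ i ∈ s, f i ^ 2 ≤ X ^ 2 + 2 * e * X + e ^ 2 * s.card := by
  have h1 : ∀ i ∈ s, f i ^ 2 ≤ X * (f i - e) + 2 * e * (f i - e) + e ^ 2 := by
    intro i hi
    have h2 : f i - e ≤ X := by
      rw [← hX]
      exact Finset.single_le_sum (f := fun i => f i - e) (fun j hj => sub_nonneg.2 (hf j hj)) hi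
    nlinarith [mul_nonneg (sub_nonneg.2 (hf i hi)) (sub_nonneg.2 h2)]
  refine (Finset.sum_le_sum h1).trans (le_of_eq ?_)
  rw [Finset.sum_add_distrib, Finset.sum_add_distrib, ← Finset.mul_sum, ← Finset.mul_sum, hX,
    Finset.sum_const, nsmul_eq_mul]
  ring

theorem full_counts (L : Type*) [Membership P L] [ProjectivePlane P L] [Fintype L]
    (hq : ProjectivePlane.order P L = p ^ 2) (hp3 : 3 ≤ p)
    {c : P → ZMod p} (hc : ∀ l : L, ∑ z with z ∈ l, c z = 0)
    (hw : hammingNorm c + 2 * p ≤ 2 * p ^ 2 + 4) {α : ZMod p} (hα : α ≠ 0) (h : 0 < cnt c α) :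
    2 * p ^ 2 + 3 ≤ hammingNorm c + cnt c α ∧
      2 * p ^ 2 + 2 * p + 4 ≤ hammingNorm c + cnt c α + cnt c (-α) := by
  obtain ⟨a, a', h1, h2, h3, -⟩ := weight_eq_of_cnt_pos L hq hp3 hc hα h hw
  omega

theorem sum_cnt_erase (c : P → ZMod p) :
    ∑ v ∈ Finset.univ.erase (0 : ZMod p), (cnt c v : ℤ) = hammingNorm c := by
  have hS : (Finset.univ.filter fun z => c z ≠ 0) = Finset.univ.filter fun z => c z ≠ 0 := rfl
  rw [← Finset.sum_congr rfl fun v hv => mult_support hS (Finset.ne_of_mem_erase hv),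
    ← sum_mult_erase_zero, ← card_eq_sum_mult, hammingNorm]
  exact mult_zero fun z hz => (Finset.mem_filter.1 hz).2

/-- Summing the lower bounds for opposite pairs leaves only w = 2p² - 2p + 4, with total slack 8
above 4p per pair. The nearly constant multiplicities then violate `quadratic_bound` by a margin of
at least 2p² - 13p - 81, which is positive from p = 11 on but not at p = 7. -/
theorem not_full_of_eleven_le (L : Type*) [Membership P L] [ProjectivePlane P L] [Fintype L]
    (hq : ProjectivePlane.order P L = p ^ 2) (hp : 11 ≤ p)
    {c : P → ZMod p} (hc : ∀ l : L, ∑ z with z ∈ l, c z = 0)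
    (hw : hammingNorm c + 2 * p ≤ 2 * p ^ 2 + 4) (hw' : 2 * p ^ 2 + 3 ≤ hammingNorm c + 2 * p)
    (hfull : ∀ α : ZMod p, α ≠ 0 → 0 < cnt c α) : False := by
  have h2 : (2 : ZMod p) ≠ 0 := two_ne_zero_of_lt (by omega)
  have hcount := fun (α : ZMod p) (hα : α ≠ 0) =>
    full_counts L hq (by omega) hc hw hα (hfull α hα)
  have hcard : ((Finset.univ.erase (0 : ZMod p)).card : ℤ) = (p : ℤ) - 1 := by
    rw [Finset.card_erase_of_mem (Finset.mem_univ _), Finset.card_univ, ZMod.card,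
      Nat.cast_sub (Fact.out : p.Prime).one_le, Nat.cast_one]
  have hsum := sum_cnt_erase c
  have hsum' := sum_erase_neg (p := p) fun v => (cnt c v : ℤ)
  have hpair : ∑ v ∈ Finset.univ.erase (0 : ZMod p), (2 * (p : ℤ) ^ 2 + 2 * p + 4 - hammingNorm c) ≤
      ∑ v ∈ Finset.univ.erase (0 : ZMod p), ((cnt c v : ℤ) + cnt c (-v)) := by
    refine Finset.sum_le_sum fun v hv => ?_
    have := (hcount v (Finset.ne_of_mem_erase hv)).2
    zify at this
    linarith
  rw [Finset.sum_add_distrib, hsum', hsum, Finset.sum_const, nsmul_eq_mul, hcard] at hpair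
  zify at hw hw' hp
  obtain ⟨w, hwdef⟩ : ∃ w : ℤ, w = hammingNorm c := ⟨_, rfl⟩
  rw [← hwdef] at hpair hw hw' hsum
  have hw2 : w = 2 * (p : ℤ) ^ 2 - 2 * p + 4 := by
    rcases (by omega : w = 2 * (p : ℤ) ^ 2 - 2 * p + 4 ∨ w = 2 * (p : ℤ) ^ 2 - 2 * p + 3) with h | h
    · exact h
    · rw [h] at hpair
      nlinarith
  obtain ⟨S, hS⟩ : ∃ S : Finset P, S = Finset.univ.filter fun z => c z ≠ 0 := ⟨_, rfl⟩
  have hcardS : (S.card : ℤ) = w := by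
    rw [hwdef, hS, hammingNorm]
  have hquad := quadratic_bound L hc (A := pairWeight) (B := 5) (d := 3)
    (fun v hv => pairWeight_self (by omega) hv) (pairWeight_line (by omega) c) hS
  have hS0 : mult c S 0 = 0 := mult_zero fun z hz => by
    rw [hS] at hz
    exact (Finset.mem_filter.1 hz).2
  rw [sum_sum_eq_sum_mult, sum_sum_pairWeight, ← card_eq_sum_mult, hcardS, hq] at hquad
  have hform := quadratic_form_le h2 (n := mult c S) (b := 2 * (p : ℤ) - 1) fun v hv => by
    rw [mult_support hS hv]
    have := (hcount v hv).1
    zify at this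
    linarith
  have hmsum : ∑ v ∈ Finset.univ.erase (0 : ZMod p), mult c S v = w := by
    rw [← sum_mult_erase_zero hS0, ← card_eq_sum_mult, hcardS]
  have hmsum' := sum_erase_neg (p := p) (mult c S)
  rw [hmsum] at hmsum'
  -- Single multiplicities are at least 2p - 1 and opposite pairs at least 4p, hence the 2. The 8 is
  -- 2w - 4p(p - 1).
  have hsq := sum_sq_le_of_sum_eq (s := Finset.univ.erase (0 : ZMod p))
    (f := fun v => mult c S v - (2 * (p : ℤ) - 1) + (mult c S (-v) - (2 * (p : ℤ) - 1))) (e := 2)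
    (X := 8) (fun v hv => by
      have hv0 := Finset.ne_of_mem_erase hv
      rw [mult_support hS hv0, mult_support hS (neg_ne_zero.2 hv0)]
      have := (hcount v hv0).2
      zify at this
      linarith) (by
      simp only [Finset.sum_add_distrib, Finset.sum_sub_distrib, hmsum, hmsum', Finset.sum_const,
        nsmul_eq_mul, hcard]
      rw [hw2]
      ring)
  have e1 := sum_mult_erase_zero (p := p) (f := fun v => mult c S v * mult c S (-v)) (by simp [hS0])
  have e2 := sum_mult_erase_zero (p := p) (f := fun v => mult c S v ^ 2) (by simp [hS0])
  have e3 := sum_mult_erase_zero (p := p) (f := fun v => mult c S v * mult c S (-2 * v))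
    (by simp [hS0])
  rw [e1, e2, e3] at hquad
  simp only [Finset.sum_add_distrib, Finset.sum_sub_distrib, ← Finset.mul_sum, hmsum,
    Finset.sum_const, nsmul_eq_mul, hcard] at hform hsq
  rw [hw2] at hquad hform
  push_cast at hquad
  nlinarith

end Full

/-! ### All values occur, p = 7 -/

section Seven

theorem four_sq_sub_ge (D : ℤ) : -3 ≤ 4 * D ^ 2 - 7 * |D| := by
  rw [← sq_abs]
  obtain h | h | h : |D| = 0 ∨ |D| = 1 ∨ 2 ≤ |D| := by have := abs_nonneg D; omega
  · rw [h]; norm_num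
  · rw [h]; norm_num
  · nlinarith

theorem four_sq_sub_ge_of_three_le {D : ℤ} (h : 3 ≤ |D|) : 6 ≤ 4 * D ^ 2 - 7 * |D| := by
  rw [← sq_abs]
  nlinarith

/-- Each term 4D² - 7|D| is at least -3, and at least 6 once |D| ≥ 3. Only |D| ≤ 2 remains, a finite
check in which the divisibility rules out the negative cases. -/
theorem lattice_form_nonneg {x y z : ℤ} (h : (7 : ℤ) ∣ x + 2 * y + 4 * z) :
    0 ≤ (x + y + z) ^ 2 + (4 * x ^ 2 - 7 * |x|) + (4 * y ^ 2 - 7 * |y|) +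
      (4 * z ^ 2 - 7 * |z|) := by
  have hx := four_sq_sub_ge x
  have hy := four_sq_sub_ge y
  have hz := four_sq_sub_ge z
  have hsq := sq_nonneg (x + y + z)
  by_cases h1 : 3 ≤ |x|
  · linarith [four_sq_sub_ge_of_three_le h1]
  by_cases h2 : 3 ≤ |y|
  · linarith [four_sq_sub_ge_of_three_le h2]
  by_cases h3 : 3 ≤ |z|
  · linarith [four_sq_sub_ge_of_three_le h3]
  clear hx hy hz hsq
  rw [not_le, abs_lt] at h1 h2 h3
  obtain ⟨h1, h1'⟩ := h1
  obtain ⟨h2, h2'⟩ := h2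
  obtain ⟨h3, h3'⟩ := h3
  interval_cases x <;> interval_cases y <;> interval_cases z <;>
    first
    | (norm_num [abs_of_nonneg, abs_of_nonpos]; done)
    | (exfalso; revert h; decide)

/-- The two sides differ by 14 min(x, y) (max(x, y) - 1). -/
theorem pair_form_ge {x y : ℤ} (hx : 0 ≤ x) (hy : 0 ≤ y) :
    4 * (x - y) ^ 2 - 7 * |x - y| ≤ 4 * (x ^ 2 + y ^ 2) + 6 * (x * y) - 7 * (x + y) := by
  obtain h | h := le_total y x
  · rw [abs_of_nonneg (sub_nonneg.2 h)]
    obtain h0 | h0 := hy.eq_or_lt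
    · rw [← h0]; nlinarith
    · nlinarith
  · rw [abs_of_nonpos (sub_nonpos.2 h)]
    obtain h0 | h0 := hx.eq_or_lt
    · rw [← h0]; nlinarith
    · nlinarith

/-- The Legendre symbol modulo `7`. -/
def legendreSeven (v : ZMod 7) : ℤ := ![0, 1, 1, -1, 1, -1, -1] v

/-- A pair weight for vectors over the field with seven elements. -/
def pairWeightSeven (u v : ZMod 7) : ℤ :=
  legendreSeven u * legendreSeven v + 4 * (if v = u then 1 else 0) + 3 * (if v = -u then 1 else 0)

theorem pairWeightSeven_self : ∀ v : ZMod 7, v ≠ 0 → pairWeightSeven v v = 5 := by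
  decide

theorem sum_zmod_seven {M : Type*} [AddCommMonoid M] (f : ZMod 7 → M) :
    ∑ v, f v = f 0 + f 1 + f 2 + f 3 + f 4 + f 5 + f 6 :=
  Fin.sum_univ_seven f

theorem sum_sum_pairWeightSeven {m : ZMod 7 → ℤ} (h0 : m 0 = 0) :
    ∑ u, ∑ v, m u * m v * pairWeightSeven u v =
      ((m 1 - m 6) + (m 2 - m 5) + (m 4 - m 3)) ^ 2 +
        (4 * (m 1 ^ 2 + m 6 ^ 2) + 6 * (m 1 * m 6)) +
        (4 * (m 2 ^ 2 + m 5 ^ 2) + 6 * (m 2 * m 5)) +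
        (4 * (m 4 ^ 2 + m 3 ^ 2) + 6 * (m 4 * m 3)) := by
  have h : ∀ u v : ZMod 7, m u * m v * pairWeightSeven u v =
      (m u * legendreSeven u) * (m v * legendreSeven v) + 4 * (if v = u then m u * m v else 0) +
        3 * (if v = -u then m u * m v else 0) := by
    intro u v
    unfold pairWeightSeven
    split_ifs <;> ring
  simp only [h, Finset.sum_add_distrib, ← Finset.mul_sum, Finset.sum_ite_eq', Finset.mem_univ,
    if_true]
  rw [← Finset.sum_mul]
  simp only [sum_zmod_seven, h0]
  have e1 : (-1 : ZMod 7) = 6 := by decide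
  have e2 : (-2 : ZMod 7) = 5 := by decide
  have e3 : (-3 : ZMod 7) = 4 := by decide
  have e4 : (-4 : ZMod 7) = 3 := by decide
  have e5 : (-5 : ZMod 7) = 2 := by decide
  have e6 : (-6 : ZMod 7) = 1 := by decide
  have l1 : legendreSeven 1 = 1 := by decide
  have l2 : legendreSeven 2 = 1 := by decide
  have l3 : legendreSeven 3 = -1 := by decide
  have l4 : legendreSeven 4 = 1 := by decide
  have l5 : legendreSeven 5 = -1 := by decide
  have l6 : legendreSeven 6 = -1 := by decide
  rw [e1, e2, e3, e4, e5, e6, l1, l2, l3, l4, l5, l6]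
  ring

theorem pair_form_le {x y e : ℤ} (hx : 13 ≤ x) (hy : 13 ≤ y) (he : x + y = 28 + e) :
    2 * (4 * (x ^ 2 + y ^ 2) + 6 * (x * y)) ≤ 7 * (28 + e) ^ 2 + (2 + e) ^ 2 ∧
      |x - y| ≤ 2 + e := by
  have h : |x - y| ≤ 2 + e := abs_le.2 ⟨by omega, by omega⟩
  refine ⟨?_, h⟩
  have h1 : (x - y) ^ 2 ≤ (2 + e) ^ 2 := sq_le_sq' (abs_le.1 h).1 (abs_le.1 h).2
  rw [← he]
  nlinarith

theorem neg_zmod_seven : (3 : ZMod 7) = -4 ∧ (5 : ZMod 7) = -2 ∧ (6 : ZMod 7) = -1 := by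
  decide

theorem ne_zero_zmod_seven : (1 : ZMod 7) ≠ 0 ∧ (2 : ZMod 7) ≠ 0 ∧ (3 : ZMod 7) ≠ 0 ∧
    (4 : ZMod 7) ≠ 0 ∧ (5 : ZMod 7) ≠ 0 ∧ (6 : ZMod 7) ≠ 0 := by
  decide

variable [Fact (Nat.Prime 7)]

/-- Only the differences of opposite multiplicities matter, by `pair_form_ge`. With the squares 1,
2, 4 as representatives, the zero sum becomes the divisibility hypothesis of `lattice_form_nonneg`.
-/
theorem pairWeightSeven_line {P : Type*} (c : P → ZMod 7) (s : Finset P)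
    (h0 : ∀ z ∈ s, c z ≠ 0) (hs : ∑ z ∈ s, c z = 0) :
    7 * (s.card : ℤ) ≤ ∑ x ∈ s, ∑ y ∈ s, pairWeightSeven (c x) (c y) := by
  have hm0 := mult_zero h0
  rw [sum_sum_eq_sum_mult, sum_sum_pairWeightSeven hm0, card_eq_sum_mult c, sum_zmod_seven, hm0]
  rw [sum_eq_sum_mult_cast, sum_zmod_seven] at hs
  have hdvd : (7 : ℤ) ∣ (mult c s 1 - mult c s 6) + 2 * (mult c s 2 - mult c s 5) +
      4 * (mult c s 4 - mult c s 3) := by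
    refine (ZMod.intCast_zmod_eq_zero_iff_dvd _ 7).1 ?_
    push_cast
    rw [← hs]
    obtain ⟨e3, e5, e6⟩ := neg_zmod_seven
    rw [e3, e5, e6]
    ring
  have h1 := pair_form_ge (mult_nonneg c s 1) (mult_nonneg c s 6)
  have h2 := pair_form_ge (mult_nonneg c s 2) (mult_nonneg c s 5)
  have h3 := pair_form_ge (mult_nonneg c s 4) (mult_nonneg c s 3)
  have h4 := lattice_form_nonneg hdvd
  linarith

theorem not_full_seven {P : Type*} [Fintype P] (L : Type*) [Membership P L] [ProjectivePlane P L]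
    [Fintype L] (hq : ProjectivePlane.order P L = 7 ^ 2)
    {c : P → ZMod 7} (hc : ∀ l : L, ∑ z with z ∈ l, c z = 0)
    (hw : hammingNorm c + 2 * 7 ≤ 2 * 7 ^ 2 + 4) (hw' : 2 * 7 ^ 2 + 3 ≤ hammingNorm c + 2 * 7)
    (hfull : ∀ α : ZMod 7, α ≠ 0 → 0 < cnt c α) : False := by
  have hcount := fun (α : ZMod 7) (hα : α ≠ 0) =>
    full_counts L hq (by omega) hc hw hα (hfull α hα)
  obtain ⟨S, hS⟩ : ∃ S : Finset P, S = Finset.univ.filter fun z => c z ≠ 0 := ⟨_, rfl⟩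
  have hcardS : S.card = hammingNorm c := by
    rw [hS, hammingNorm]
  have hS0 : mult c S 0 = 0 := mult_zero fun z hz => by
    rw [hS] at hz
    exact (Finset.mem_filter.1 hz).2
  have hquad := quadratic_bound L hc (A := pairWeightSeven) (B := 7) (d := 5)
    pairWeightSeven_self (pairWeightSeven_line c) hS
  rw [sum_sum_eq_sum_mult, sum_sum_pairWeightSeven hS0, hq] at hquad
  have hsum := card_eq_sum_mult c S
  rw [sum_zmod_seven, hS0] at hsum
  obtain ⟨n1, n2, n3, n4, n5, n6⟩ := ne_zero_zmod_seven
  have g1 := hcount 1 n1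
  have g2 := hcount 2 n2
  have g4 := hcount 4 n4
  have g3 := hcount 3 n3
  have g5 := hcount 5 n5
  have g6 := hcount 6 n6
  obtain ⟨e3, e5, e6⟩ := neg_zmod_seven
  rw [← e6] at g1
  rw [← e5] at g2
  rw [← e3] at g4
  rw [← hcardS] at g1 g2 g3 g4 g5 g6 hw hw'
  zify at g1 g2 g3 g4 g5 g6 hw hw'
  have k : ∀ v : ZMod 7, v ≠ 0 → (cnt c v : ℤ) = mult c S v := fun v hv => (mult_support hS hv).symm
  rw [k 1 n1, k 6 n6] at g1
  rw [k 2 n2, k 5 n5] at g2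
  rw [k 4 n4, k 3 n3] at g4
  rw [k 3 n3] at g3
  rw [k 5 n5] at g5
  rw [k 6 n6] at g6
  generalize (S.card : ℤ) = w at *
  generalize mult c S 1 = m1 at *
  generalize mult c S 2 = m2 at *
  generalize mult c S 3 = m3 at *
  generalize mult c S 4 = m4 at *
  generalize mult c S 5 = m5 at *
  generalize mult c S 6 = m6 at *
  obtain ⟨x, hx⟩ : ∃ x, m1 + m6 = 28 + x := ⟨m1 + m6 - 28, by ring⟩
  obtain ⟨y, hy⟩ : ∃ y, m2 + m5 = 28 + y := ⟨m2 + m5 - 28, by ring⟩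
  obtain ⟨z, hz⟩ : ∃ z, m4 + m3 = 28 + z := ⟨m4 + m3 - 28, by ring⟩
  obtain ⟨p1, d1⟩ := pair_form_le (by omega) (by omega) hx
  obtain ⟨p2, d2⟩ := pair_form_le (by omega) (by omega) hy
  obtain ⟨p3, d3⟩ := pair_form_le (by omega) (by omega) hz
  have hd : ((m1 - m6) + (m2 - m5) + (m4 - m3)) ^ 2 ≤ (6 + x + y + z) ^ 2 := by
    rw [abs_le] at d1 d2 d3
    exact sq_le_sq' (by linarith) (by linarith)
  push_cast at hquad
  have hx0 : 0 ≤ x := by omega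
  have hy0 : 0 ≤ y := by omega
  have hz0 : 0 ≤ z := by omega
  have hxyz : x + y + z = w - 84 := by omega
  have hsq : x ^ 2 + y ^ 2 + z ^ 2 ≤ (w - 84) ^ 2 := by
    rw [← hxyz]
    nlinarith [mul_nonneg hx0 hy0, mul_nonneg hx0 hz0, mul_nonneg hy0 hz0]
  rw [show 6 + x + y + z = w - 78 by linarith] at hd
  -- The quadratic form would have to reach 105w, which is 9135 or 9240, but the estimates allow at
  -- most 8949 or 9194.
  obtain rfl | rfl : w = 87 ∨ w = 88 := by omega
  · linarith
  · linarith

end Seven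

/-! ### Words with values 0, 1, -1 -/

section TwoValued

variable {P : Type*} {p : ℕ} [Fact p.Prime]

theorem sum_val_of_two_valued {c : P → ZMod p} (hp3 : 3 ≤ p)
    (h : ∀ z, c z = 0 ∨ c z = 1 ∨ c z = -1) (s : Finset P) :
    ∑ z ∈ s, (c z).val =
      (s.filter fun z => c z = 1).card + (p - 1) * (s.filter fun z => c z = -1).card := by
  have : Fact (1 < p) := ⟨by omega⟩
  have h1 : ((-1 : ZMod p)).val = p - 1 := val_eq_pred_iff.2 rfl
  have hne : (1 : ZMod p) ≠ -1 := fun h => by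
    have := val_eq_pred_iff.2 h
    rw [ZMod.val_one] at this
    omega
  rw [Finset.card_filter, Finset.card_filter, Finset.mul_sum, ← Finset.sum_add_distrib]
  refine Finset.sum_congr rfl fun z _ => ?_
  obtain h | h | h := h z
  · simp [h, eq_comm (a := (0 : ZMod p))]
  · simp [h, ZMod.val_one, hne]
  · simp [h, h1, hne.symm]

theorem line_equation [Fintype P] {L : Type*} [Membership P L] {c : P → ZMod p} (hp3 : 3 ≤ p)
    (h : ∀ z, c z = 0 ∨ c z = 1 ∨ c z = -1) {x : P} (hx : c x = 1) {l : L} (hl : x ∈ l) {k : ℕ}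
    (hk : ∑ z ∈ others x l, (c z).val + 1 = p * (1 + k)) :
    (Finset.univ.filter fun z => c z = 1 ∧ z ∈ l).card +
      (p - 1) * (Finset.univ.filter fun z => c z = -1 ∧ z ∈ l).card = p * (1 + k) := by
  have : Fact (1 < p) := ⟨by omega⟩
  have h1 : others x l = (Finset.univ.filter fun z => z ∈ l).erase x := by
    ext z
    simp [others, and_comm]
  have h2 := Finset.add_sum_erase (Finset.univ.filter fun z => z ∈ l) (fun z => (c z).val) (a := x)
    (by simp [hl])
  rw [← h1, hx, ZMod.val_one, add_comm, hk, sum_val_of_two_valued hp3 h, Finset.filter_filter,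
    Finset.filter_filter] at h2
  simp only [and_comm] at h2 ⊢
  exact h2.symm

/-- The number of points of a set on a line. -/
noncomputable def onLine {L : Type*} [Membership P L] (X : Finset P) (l : L) : ℕ :=
  (X.filter fun z => z ∈ l).card

theorem eq_of_balance {p n m t : ℤ} (hp : 7 ≤ p) (h : (p - 2) * (n - m) = p * t) (ht : |t| ≤ 2) :
    n = m ∧ t = 0 := by
  have h1 : (p - 2) * (n - m - t) = 2 * t := by linarith
  have h2 : n - m - t = 0 := by
    by_contra h0
    have h3 : 1 ≤ |n - m - t| := Int.one_le_abs h0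
    have h4 : |(p - 2) * (n - m - t)| = |2 * t| := by rw [h1]
    rw [abs_mul, abs_mul, abs_of_nonneg (by linarith : (0 : ℤ) ≤ p - 2),
      abs_of_nonneg (by norm_num : (0 : ℤ) ≤ 2)] at h4
    nlinarith
  rw [h2, mul_zero] at h1
  omega

/-- The shape of a set of points in a plane of order `p ^ 2` such that the lines through two of its
points contain `p` of its points: in the second case there is one exception through every point. -/
def PlaneLike (L : Type*) [Membership P L] (p : ℕ) (X : Finset P) : Prop :=
  X.card + p = p ^ 2 + 1 ∧ ∀ l : L, 2 ≤ onLine X l → onLine X l = p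

/-- The point set of an antipodal plane whose lines have `p` points. -/
def AntipodalLike (L : Type*) [Membership P L] (p : ℕ) (X : Finset P) : Prop :=
  X.card + p = p ^ 2 + 2 ∧ (∀ l : L, 2 ≤ onLine X l → onLine X l = p ∨ onLine X l = 2) ∧
    ∀ x ∈ X, ∃! l : L, x ∈ l ∧ onLine X l = 2

variable {L : Type*} [Membership P L] [ProjectivePlane P L] [Fintype L]

theorem card_le_of_notMem (X : Finset P) {z : P} (l : L) (hz : z ∉ l) :
    onLine X l ≤ ((pencil L z).filter fun m => ∃ y ∈ X, y ≠ z ∧ y ∈ m).card := by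
  refine Finset.card_le_card_of_injOn
    (fun y => if h : y ≠ z then HasLines.mkLine (L := L) h else l) (fun y hy => ?_) ?_
  · simp only [Finset.coe_filter, Set.mem_ofPred_eq] at hy
    have hyz : y ≠ z := fun h => hz (h ▸ hy.2)
    simp only [hyz, ne_eq, not_false_eq_true, dif_pos, Finset.coe_filter, pencil, Finset.mem_filter,
      Finset.mem_univ, true_and, Set.mem_ofPred_eq]
    exact ⟨(HasLines.mkLine_ax hyz).2, y, hy.1, hyz, (HasLines.mkLine_ax hyz).1⟩
  · intro y hy y' hy' h
    simp only [Finset.coe_filter, Set.mem_ofPred_eq] at hy hy'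
    have hyz : y ≠ z := fun h => hz (h ▸ hy.2)
    have hyz' : y' ≠ z := fun h => hz (h ▸ hy'.2)
    simp only [hyz, hyz', ne_eq, not_false_eq_true, dif_pos] at h
    have h1 := HasLines.mkLine_ax (L := L) hyz
    have h2 := HasLines.mkLine_ax (L := L) hyz'
    rw [← h] at h2
    refine (Nondegenerate.eq_or_eq hy.2 hy'.2 h1.1 h2.1).resolve_right fun h3 => hz ?_
    rw [h3]
    exact h1.2

variable [Fintype P]

theorem sum_onLine (X : Finset P) {x : P} (hx : x ∈ X) :
    ∑ l ∈ pencil L x, onLine X l = X.card + ProjectivePlane.order P L := by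
  have h1 : ∀ l ∈ pencil L x, onLine X l = ((others x l).filter fun z => z ∈ X).card + 1 := by
    intro l hl
    have hl' : x ∈ l := (Finset.mem_filter.1 hl).2
    rw [onLine, ← Finset.card_erase_add_one (Finset.mem_filter.2 ⟨hx, hl'⟩)]
    congr 2
    ext z
    simp only [others, Finset.mem_erase, Finset.mem_filter, Finset.mem_univ, true_and]
    tauto
  rw [Finset.sum_congr rfl h1, Finset.sum_add_distrib, sum_pencil_card, Finset.sum_const,
    card_pencil, smul_eq_mul, mul_one]
  have h2 := card_filter_erase_add_one (Q := fun z => z ∈ X) hx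
  rw [show (Finset.univ.filter fun z => z ∈ X) = X by ext; simp] at h2
  omega

set_option maxHeartbeats 400000 in
-- A line through a point of X, the set of value 1, satisfies |X ∩ l| + (p - 1)|Y ∩ l| = p(1 + k),
-- where Y is the set of value -1. For k = 0, two points of X force p of them. For k = 1 the
-- candidates are (2p, 0), (p + 1, 1) and (2, 2), and only the last survives. Since a = a' ≤ 1,
-- either k = 0 throughout or each point of X lies on exactly one line with k = 1.
theorem two_valued_structure (L : Type*) [Membership P L] [ProjectivePlane P L] [Fintype L]
    (hq : ProjectivePlane.order P L = p ^ 2) (hp7 : 7 ≤ p)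
    {c : P → ZMod p} (hc : ∀ l : L, ∑ z with z ∈ l, c z = 0)
    (hw : hammingNorm c + 2 * p ≤ 2 * p ^ 2 + 4) (h1 : 0 < cnt c 1)
    (htwo : ∀ z, c z = 0 ∨ c z = 1 ∨ c z = -1) :
    ∃ X : Finset P, PlaneLike L p X ∨ AntipodalLike L p X := by
  have hp3 : 3 ≤ p := by omega
  obtain ⟨x₀, hx₀⟩ := cnt_pos_iff.1 h1
  obtain ⟨a, a', hwa, ha, hopp, -⟩ := weight_eq_of_eq_one L hq hp3 hc hx₀ hw
  obtain ⟨X, hX⟩ : ∃ X : Finset P, X = Finset.univ.filter fun z => c z = 1 := ⟨_, rfl⟩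
  obtain ⟨Y, hY⟩ : ∃ Y : Finset P, Y = Finset.univ.filter fun z => c z = -1 := ⟨_, rfl⟩
  have hXmem : ∀ z, z ∈ X ↔ c z = 1 := by simp [hX]
  have hYmem : ∀ z, z ∈ Y ↔ c z = -1 := by simp [hY]
  have hne : (1 : ZMod p) ≠ -1 := fun h => by
    have : Fact (1 < p) := ⟨by omega⟩
    have := val_eq_pred_iff.2 h
    rw [ZMod.val_one] at this
    omega
  have hcard : hammingNorm c = X.card + Y.card := by
    rw [hammingNorm, hX, hY]
    refine card_filter_eq_add (fun z => ?_) fun z hz hz' => hne (hz.symm.trans hz')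
    obtain h | h | h := htwo z <;> simp [h]
  have hval := sum_val_of_two_valued hp3 htwo Finset.univ
  rw [← hX, ← hY] at hval
  rw [hval] at ha
  -- The total lift and the weight formula combine to (p - 2)(|X| - |Y|) = p(a' - a).
  have hbal : (X.card : ℤ) = Y.card ∧ (a' : ℤ) - a = 0 := by
    refine eq_of_balance (p := p) (by exact_mod_cast hp7) ?_ (abs_le.2 ⟨by omega, by omega⟩)
    rw [hcard] at hwa
    zify [(by omega : 1 ≤ p)] at ha hwa
    have h3 : (p : ℤ) * (X.card + Y.card + 2 * p) = p * (2 * p ^ 2 + 2 + (a + a')) := by rw [hwa]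
    linarith
  obtain ⟨hXY, haa⟩ := hbal
  have hXY' : X.card = Y.card := by exact_mod_cast hXY
  have haa' : a' = a := by omega
  have hXcard : X.card + p = p ^ 2 + 1 + a := by omega
  have hX0 : ∀ l : L, (Finset.univ.filter fun z => c z = 1 ∧ z ∈ l).card = onLine X l := fun l => by
    rw [onLine, hX, Finset.filter_filter]
  have hY0 : ∀ l : L,
      (Finset.univ.filter fun z => c z = -1 ∧ z ∈ l).card = onLine Y l := fun l => by
    rw [onLine, hY, Finset.filter_filter]
  have hsuma : ∑ z, (c z).val + p ^ 2 = p * (p ^ 2 + 1 + a) := by rw [hval, ha]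
  have hx_line : ∀ x ∈ X, ∃ k : L → ℕ, ∑ l ∈ pencil L x, k l = a ∧
      ∀ l ∈ pencil L x, onLine X l + (p - 1) * onLine Y l = p * (1 + k l) := by
    intro x hx
    rw [hXmem] at hx
    obtain ⟨k, hk, hk1, -⟩ := pencil_bounds hp3 L hc hx
    refine ⟨k, ?_, fun l hl => ?_⟩
    · rw [hq, hsuma] at hk1
      have := Nat.eq_of_mul_eq_mul_left (by omega : 0 < p) hk1
      omega
    · rw [← hX0, ← hY0]
      exact line_equation hp3 htwo hx (Finset.mem_filter.1 hl).2 (hk l hl)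
  have hy_line : ∀ x ∈ Y, ∃ k : L → ℕ, ∑ l ∈ pencil L x, k l = a ∧
      ∀ l ∈ pencil L x, onLine Y l + (p - 1) * onLine X l = p * (1 + k l) := by
    intro x hx
    rw [hYmem] at hx
    obtain ⟨k, hk, hk1, -⟩ := pencil_bounds hp3 L (c := -c) (fun l => by simp [hc l]) (x := x)
      (by simp [hx])
    have htwo' : ∀ z, (-c) z = 0 ∨ (-c) z = 1 ∨ (-c) z = -1 := by
      intro z
      rw [Pi.neg_apply]
      obtain h | h | h := htwo z <;> simp [h]
    refine ⟨k, ?_, fun l hl => ?_⟩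
    · have hs := sum_neg_val c
      rw [hcard, ← hXY'] at hs
      rw [hq] at hk1
      refine Nat.eq_of_mul_eq_mul_left (by omega : 0 < p) ?_
      have h4 : p * (X.card + X.card + 2 * p) = p * (2 * (p ^ 2 + 1 + a)) := by
        congr 1
        omega
      linarith
    · have := line_equation hp3 htwo' (by simp [hx]) (Finset.mem_filter.1 hl).2 (hk l hl)
      simp only [Pi.neg_apply, neg_eq_iff_eq_neg, neg_neg, hX0, hY0] at this
      exact this
  have hmem_of_two : ∀ l : L, 1 ≤ onLine X l → ∃ x ∈ X, x ∈ l := by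
    intro l hl
    obtain ⟨x, hx⟩ := Finset.card_pos.1 (Nat.lt_of_lt_of_le one_pos hl)
    rw [Finset.mem_filter] at hx
    exact ⟨x, hx⟩
  have hle : a ≤ 1 := by omega
  have hk_le : ∀ {x : P} {k : L → ℕ} {l : L}, ∑ l ∈ pencil L x, k l = a → l ∈ pencil L x →
      k l ≤ a := fun hk hl => hk ▸ Finset.single_le_sum (fun _ _ => Nat.zero_le _) hl
  have hzero : ∀ {i j : ℕ}, 2 ≤ i → i + (p - 1) * j = p * (1 + 0) → i = p := by
    intro i j hi hij
    obtain _ | j := j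
    · omega
    · have : (p - 1) * 1 ≤ (p - 1) * (j + 1) := Nat.mul_le_mul_left _ (by omega)
      omega
  refine ⟨X, ?_⟩
  obtain rfl | rfl : a = 0 ∨ a = 1 := by omega
  · refine Or.inl ⟨hXcard, fun l hl => ?_⟩
    obtain ⟨x, hx, hxl⟩ := hmem_of_two l (by omega)
    obtain ⟨k, hk, hkl⟩ := hx_line x hx
    have hl' : l ∈ pencil L x := Finset.mem_filter.2 ⟨Finset.mem_univ _, hxl⟩
    have := hkl l hl'
    rw [Nat.le_zero.1 (hk_le hk hl')] at this
    exact hzero hl this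
  · right
    -- From a point z of X off l, 2p points on l would give 2p secants through z, all but at most
    -- one carrying p points, which is more than X contains.
    have hcount : ∀ l : L, 2 ≤ onLine X l → onLine X l < 2 * p := by
      intro l hl
      by_contra hlt
      obtain ⟨z, hz, hzl⟩ : ∃ z ∈ X, z ∉ l := by
        by_contra hno
        push Not at hno
        obtain ⟨x, hx, hxl⟩ := hmem_of_two l (by omega)
        obtain ⟨k, hk, hkl⟩ := hx_line x hx
        have hl' : l ∈ pencil L x := Finset.mem_filter.2 ⟨Finset.mem_univ _, hxl⟩
        have h3 := hkl l hl'
        have h4 := hk_le hk hl'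
        have h5 : onLine X l = X.card := by rw [onLine, Finset.filter_true_of_mem hno]
        have h6 : p * (1 + k l) ≤ p * 2 := Nat.mul_le_mul_left _ (by omega)
        nlinarith
      obtain ⟨k, hk, hkl⟩ := hx_line z hz
      have h3 := card_le_of_notMem X l hzl
      have h4 := sum_onLine (L := L) X hz
      rw [hq] at h4
      have h5 : ∀ m ∈ pencil L z, (p - 1) * (if ∃ y ∈ X, y ≠ z ∧ y ∈ m then 1 else 0) + 1 ≤
          onLine X m + p * k m := by
        intro m hm
        have hzm : z ∈ m := (Finset.mem_filter.1 hm).2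
        split_ifs with hy
        · obtain ⟨y, hy, hyz, hym⟩ := hy
          have h6 : 2 ≤ onLine X m := Finset.one_lt_card.2
            ⟨y, Finset.mem_filter.2 ⟨hy, hym⟩, z, Finset.mem_filter.2 ⟨hz, hzm⟩, hyz⟩
          obtain h7 | h7 := Nat.eq_zero_or_pos (k m)
          · have h8 := hkl m hm
            rw [h7] at h8
            have := hzero h6 h8
            omega
          · have : p * 1 ≤ p * k m := Nat.mul_le_mul_left _ h7
            omega
        · have h6 : 1 ≤ onLine X m := Finset.card_pos.2 ⟨z, Finset.mem_filter.2 ⟨hz, hzm⟩⟩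
          omega
      have h6 := Finset.sum_le_sum h5
      rw [Finset.sum_add_distrib, Finset.sum_add_distrib, ← Finset.mul_sum, ← Finset.mul_sum, hk,
        h4, Finset.sum_const, card_pencil, hq, ← Finset.card_filter, smul_eq_mul] at h6
      have h7 : (p - 1) * (2 * p) ≤
          (p - 1) * ((pencil L z).filter fun m => ∃ y ∈ X, y ≠ z ∧ y ∈ m).card :=
        Nat.mul_le_mul_left _ (by omega)
      have h8 : (p - 1) * (2 * p) + 2 * p = 2 * p ^ 2 := by
        obtain ⟨r, rfl⟩ : ∃ r, p = r + 1 := ⟨p - 1, by omega⟩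
        rw [Nat.add_sub_cancel]
        ring
      have h9 : 7 * p ≤ p ^ 2 := by rw [sq]; exact Nat.mul_le_mul_right _ hp7
      omega
    have hone : ∀ x ∈ X, ∀ k : ℕ, k = 1 → ∀ l : L, x ∈ l →
        onLine X l + (p - 1) * onLine Y l = p * (1 + k) → onLine X l = 2 := by
      rintro x hx k rfl l hxl hl
      have hpos : 1 ≤ onLine X l := Finset.card_pos.2 ⟨x, Finset.mem_filter.2 ⟨hx, hxl⟩⟩
      have hj : onLine Y l ≤ 2 := by
        by_contra hj
        have : (p - 1) * 3 ≤ (p - 1) * onLine Y l := Nat.mul_le_mul_left _ (by omega)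
        omega
      obtain hj | hj | hj : onLine Y l = 0 ∨ onLine Y l = 1 ∨ onLine Y l = 2 := by omega
      · rw [hj] at hl
        have := hcount l (by omega)
        omega
      -- Seen from the point of Y, the line has lifted total 1 + (p - 1)(p + 1) = p² > 2p.
      · exfalso
        obtain ⟨y, hy⟩ := Finset.card_pos.1 (by rw [onLine] at hj; omega :
          0 < (Y.filter fun z => z ∈ l).card)
        rw [Finset.mem_filter] at hy
        obtain ⟨k, hk, hkl⟩ := hy_line y hy.1
        have hl' : l ∈ pencil L y := Finset.mem_filter.2 ⟨Finset.mem_univ _, hy.2⟩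
        have h3 := hkl l hl'
        have h4 := hk_le hk hl'
        have h5 : p * (1 + k l) ≤ p * 2 := Nat.mul_le_mul_left _ (by omega)
        rw [hj] at hl h3
        have h6 : onLine X l = p + 1 := by omega
        rw [h6] at h3
        obtain ⟨r, rfl⟩ : ∃ r, p = r + 1 := ⟨p - 1, by omega⟩
        simp only [Nat.add_sub_cancel] at h3
        nlinarith
      · rw [hj] at hl
        omega
    refine ⟨hXcard, fun l hl => ?_, fun x hx => ?_⟩
    · obtain ⟨x, hx, hxl⟩ := hmem_of_two l (by omega)
      obtain ⟨k, hk, hkl⟩ := hx_line x hx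
      have hl' : l ∈ pencil L x := Finset.mem_filter.2 ⟨Finset.mem_univ _, hxl⟩
      have h3 := hkl l hl'
      have h4 := hk_le hk hl'
      obtain h5 | h5 : k l = 0 ∨ k l = 1 := by omega
      · rw [h5] at h3
        exact Or.inl (hzero hl h3)
      · exact Or.inr (hone x hx _ h5 l hxl h3)
    · obtain ⟨k, hk, hkl⟩ := hx_line x hx
      obtain ⟨l, hl, hl0⟩ : ∃ l ∈ pencil L x, k l ≠ 0 := by
        by_contra hno
        push Not at hno
        rw [Finset.sum_eq_zero hno] at hk
        omega
      have hxl : x ∈ l := (Finset.mem_filter.1 hl).2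
      have h4 := hk_le hk hl
      refine ⟨l, ⟨hxl, hone x hx _ (by omega) l hxl (hkl l hl)⟩, ?_⟩
      rintro m ⟨hxm, hm⟩
      have hm' : m ∈ pencil L x := Finset.mem_filter.2 ⟨Finset.mem_univ _, hxm⟩
      by_contra hml
      have h5 : k m = 0 := by
        have := Finset.add_sum_erase (pencil L x) k hl
        have h6 : k m ≤ ∑ m ∈ (pencil L x).erase l, k m :=
          Finset.single_le_sum (fun _ _ => Nat.zero_le _) (Finset.mem_erase.2 ⟨hml, hm'⟩)
        omega
      have h6 := hkl m hm'
      rw [h5] at h6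
      have := hzero hm.ge h6
      omega

end TwoValued

/-! ### Nonexistence of nets in the affine plane -/

section AffineNet

variable {K : Type*} [Field K]

/-- The field element `r` is the ratio of a homothety with centre `x₀` that preserves `A`. -/
def IsHomothety (A : Finset K) (x₀ r : K) : Prop :=
  r ≠ 0 ∧ r ≠ 1 ∧ ∀ x ∈ A, x₀ + r * (x - x₀) ∈ A

/-- Both affine maps are bijections from A to B, so the second followed by the inverse of the first
permutes A and fixes x₀. -/
theorem IsHomothety.of_slopes {A B : Finset K} (hAB : A.card = B.card) {x₀ y₀ m m' : K}
    (hm : m ≠ 0) (hm' : m' ≠ 0) (hne : m ≠ m') (h : ∀ x ∈ A, y₀ + m * (x - x₀) ∈ B)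
    (h' : ∀ x ∈ A, y₀ + m' * (x - x₀) ∈ B) : IsHomothety A x₀ (m' / m) := by
  refine ⟨div_ne_zero hm' hm, fun h1 => hne ((div_eq_one_iff_eq hm).1 h1).symm, fun x hx => ?_⟩
  obtain ⟨x', hx', hxx⟩ := Finset.surj_on_of_inj_on_of_card_le (fun x _ => y₀ + m * (x - x₀)) h
    (fun a b _ _ hab => by simpa [hm] using hab) hAB.ge _ (h' x hx)
  have : x₀ + m' / m * (x - x₀) = x' := by
    field_simp
    linear_combination hxx
  rwa [this]

/-- The commutator of two homotheties with distinct centres is a nontrivial translation. -/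
theorem exists_translation {A : Finset K} {x₀ x₁ r s : K} (hx : x₀ ≠ x₁)
    (hr : IsHomothety A x₀ r) (hs : IsHomothety A x₁ s) : ∃ t ≠ 0, ∀ x ∈ A, x + t ∈ A := by
  refine ⟨(x₀ - x₁) * (1 - r) * (1 - s), mul_ne_zero (mul_ne_zero (sub_ne_zero.2 hx)
    (sub_ne_zero.2 hr.2.1.symm)) (sub_ne_zero.2 hs.2.1.symm), fun x hxA => ?_⟩
  obtain ⟨y, hy, hyx⟩ := Finset.surj_on_of_inj_on_of_card_le
    (fun x _ => x₁ + s * ((x₀ + r * (x - x₀)) - x₁)) (fun x hx => hs.2.2 _ (hr.2.2 x hx))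
    (fun a b _ _ hab => by simpa [hs.1, hr.1] using hab) le_rfl x hxA
  have := hr.2.2 _ (hs.2.2 y hy)
  convert this using 1
  rw [hyx]
  ring

variable {p : ℕ}

theorem add_mul_mem [Fact p.Prime] (ι : ZMod p →+* K) {A : Finset K} {t : K}
    (h : ∀ x ∈ A, x + t ∈ A) {a : K} (ha : a ∈ A) (i : ZMod p) : a + ι i * t ∈ A := by
  have key : ∀ n : ℕ, a + n * t ∈ A := by
    intro n
    induction n with
    | zero => simpa using ha
    | succ n ih =>
      have := h _ ih
      rw [Nat.cast_succ, add_mul, one_mul, ← add_assoc]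
      exact this
  have := key i.val
  rwa [← map_natCast ι, ZMod.natCast_zmod_val] at this

theorem card_le_of_translation [Fact p.Prime] (ι : ZMod p →+* K) {A : Finset K} {t : K} (ht : t ≠ 0)
    (h : ∀ x ∈ A, x + t ∈ A) {a : K} (ha : a ∈ A) :
    p ≤ A.card ∧ (A.card = p → ∀ x ∈ A, ∃ i, x = a + ι i * t) := by
  have hinj : Function.Injective fun i => a + ι i * t := fun i j hij => by
    exact ι.injective (mul_right_cancel₀ ht (add_left_cancel hij))
  have hsub : Finset.univ.image (fun i => a + ι i * t) ⊆ A := by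
    intro x hx
    obtain ⟨i, -, rfl⟩ := Finset.mem_image.1 hx
    exact add_mul_mem ι h ha i
  have hcard : (Finset.univ.image fun i => a + ι i * t).card = p := by
    rw [Finset.card_image_of_injective _ hinj, Finset.card_univ, ZMod.card]
  refine ⟨hcard ▸ Finset.card_le_card hsub, fun hA x hx => ?_⟩
  rw [← Finset.eq_of_subset_of_card_le hsub (by omega)] at hx
  obtain ⟨i, -, hi⟩ := Finset.mem_image.1 hx
  exact ⟨i, hi.symm⟩

theorem card_image_of_fibers {α β : Type*} {S : Finset α} {f : α → β} {n k : ℕ}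
    (hk : 0 < k) (hS : S.card = n * k) (h : ∀ z ∈ S, (S.filter fun w => f w = f z).card = k) :
    (S.image f).card = n := by
  have h1 := Finset.card_eq_sum_card_image f S
  rw [Finset.sum_congr rfl fun b hb => ?_, Finset.sum_const, smul_eq_mul, hS] at h1
  · exact (Nat.eq_of_mul_eq_mul_right hk h1).symm
  · obtain ⟨z, hz, rfl⟩ := Finset.mem_image.1 hb
    exact h z hz

theorem exists_mem_avoiding {α : Type*} (s : Finset α) (l : List α) (h : l.length < s.card) :
    ∃ x ∈ s, x ∉ l := by
  by_contra! hno
  have : s ⊆ l.toFinset := fun x hx => List.mem_toFinset.2 (hno x hx)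
  have := (Finset.card_le_card this).trans l.toFinset_card_le
  omega

/-- A set of points in the affine plane, each of whose nonempty rows and columns has `p - 1`
elements, in which every point can be joined to every other point outside its row and column and
different from one exceptional point, by a line that contains `n` points of the set. -/
structure IsNet (p n : ℕ) (S : Finset (K × K)) : Prop where
  card : S.card = n * (p - 1)
  column : ∀ z ∈ S, (S.filter fun w => w.1 = z.1).card = p - 1
  row : ∀ z ∈ S, (S.filter fun w => w.2 = z.2).card = p - 1
  line : ∀ z ∈ S, ∃ e, ∀ z' ∈ S, z' ≠ e → z'.1 ≠ z.1 → z'.2 ≠ z.2 →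
    n ≤ (S.filter fun w => (w.2 - z.2) * (z'.1 - z.1) = (z'.2 - z.2) * (w.1 - z.1)).card

namespace IsNet

variable {n : ℕ} {S : Finset (K × K)}

theorem card_fst (h : IsNet p n S) (hp : 2 ≤ p) : (S.image Prod.fst).card = n :=
  card_image_of_fibers (by omega) h.card h.column

theorem card_snd (h : IsNet p n S) (hp : 2 ≤ p) : (S.image Prod.snd).card = n :=
  card_image_of_fibers (by omega) h.card h.row

/-- Such a line meets each column at most once and there are n columns, so its n points meet them
all. -/
theorem mem_of_line (h : IsNet p n S) (hp : 2 ≤ p) {z : K × K} (hz : z ∈ S) :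
    ∃ e, ∀ z' ∈ S, z' ≠ e → z'.1 ≠ z.1 → z'.2 ≠ z.2 → ∀ x ∈ S.image Prod.fst,
      (x, z.2 + (z'.2 - z.2) / (z'.1 - z.1) * (x - z.1)) ∈ S := by
  obtain ⟨e, he⟩ := h.line z hz
  refine ⟨e, fun z' hz' h1 h2 h3 x hx => ?_⟩
  have hne : z'.1 - z.1 ≠ 0 := sub_ne_zero.2 h2
  have hl := he z' hz' h1 h2 h3
  have heq : ∀ w ∈ S.filter fun w => (w.2 - z.2) * (z'.1 - z.1) = (z'.2 - z.2) * (w.1 - z.1),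
      w = (w.1, z.2 + (z'.2 - z.2) / (z'.1 - z.1) * (w.1 - z.1)) := by
    intro w hw
    refine Prod.ext rfl ?_
    field_simp
    linear_combination (Finset.mem_filter.1 hw).2
  have himage := Finset.eq_of_subset_of_card_le
    (Finset.image_subset_image (f := Prod.fst) (Finset.filter_subset
      (fun w : K × K => (w.2 - z.2) * (z'.1 - z.1) = (z'.2 - z.2) * (w.1 - z.1)) S))
    (by
      rw [h.card_fst hp, Finset.card_image_of_injOn]
      · exact hl
      · intro w hw w' hw' hww
        rw [heq w hw, heq w' hw', hww])
  rw [← himage] at hx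
  obtain ⟨w, hw, rfl⟩ := Finset.mem_image.1 hx
  rw [← heq w hw]
  exact (Finset.mem_filter.1 hw).1

theorem exists_mem_column (h : IsNet p n S) {x : K} (hx : x ∈ S.image Prod.fst) (l : List (K × K))
    (hl : l.length < p - 1) : ∃ w ∈ S, w.1 = x ∧ w ∉ l := by
  obtain ⟨z, hz, rfl⟩ := Finset.mem_image.1 hx
  obtain ⟨w, hw, hwl⟩ := exists_mem_avoiding _ l (hl.trans_eq (h.column z hz).symm)
  rw [Finset.mem_filter] at hw
  exact ⟨w, hw.1, hw.2, hwl⟩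

/-- Joining z to two points of another column gives two slopes, to which `IsHomothety.of_slopes`
applies. -/
theorem exists_homothety (h : IsNet p n S) (hp : 7 ≤ p) (hn : 2 ≤ n) {z : K × K} (hz : z ∈ S) :
    ∃ m r, m ≠ 0 ∧ (∀ x ∈ S.image Prod.fst, z.2 + m * (x - z.1) ∈ S.image Prod.snd) ∧
      IsHomothety (S.image Prod.fst) z.1 r := by
  obtain ⟨e, he⟩ := h.mem_of_line (by omega) hz
  obtain ⟨x₁, hx₁, hx⟩ := exists_mem_avoiding (S.image Prod.fst) [z.1]
    (by rw [h.card_fst (by omega), List.length_singleton]; omega)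
  obtain ⟨w, hw, hw1, hwl⟩ := h.exists_mem_column hx₁ [(x₁, z.2), e] (by simp; omega)
  obtain ⟨w', hw', hw1', hwl'⟩ := h.exists_mem_column hx₁ [(x₁, z.2), e, w] (by simp; omega)
  simp only [List.mem_cons, List.not_mem_nil, or_false, not_or] at hx hwl hwl'
  have hw2 : w.2 ≠ z.2 := fun h => hwl.1 (Prod.ext hw1 h)
  have hw2' : w'.2 ≠ z.2 := fun h => hwl'.1 (Prod.ext hw1' h)
  have hx0 : x₁ - z.1 ≠ 0 := sub_ne_zero.2 hx
  have h1 := he w hw hwl.2 (by rwa [hw1]) hw2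
  have h2 := he w' hw' hwl'.2.1 (by rwa [hw1']) hw2'
  rw [hw1] at h1
  rw [hw1'] at h2
  have h3 : ∀ x ∈ S.image Prod.fst,
      z.2 + (w.2 - z.2) / (x₁ - z.1) * (x - z.1) ∈ S.image Prod.snd :=
    fun x hx => Finset.mem_image_of_mem Prod.snd (h1 x hx)
  have h4 : ∀ x ∈ S.image Prod.fst,
      z.2 + (w'.2 - z.2) / (x₁ - z.1) * (x - z.1) ∈ S.image Prod.snd :=
    fun x hx => Finset.mem_image_of_mem Prod.snd (h2 x hx)
  have hm0 : (w.2 - z.2) / (x₁ - z.1) ≠ 0 := div_ne_zero (sub_ne_zero.2 hw2) hx0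
  refine ⟨_, _, hm0, h3, IsHomothety.of_slopes
    ((h.card_fst (by omega)).trans (h.card_snd (by omega)).symm) hm0
    (div_ne_zero (sub_ne_zero.2 hw2') hx0) (fun hm => ?_) h3 h4⟩
  refine hwl'.2.2 (Prod.ext (hw1'.trans hw1.symm) ?_)
  rw [div_left_inj' hx0] at hm
  exact (sub_left_inj.1 hm).symm

/-- Two centres yield a translation of the first coordinates, whose orbits have p elements, so n = p
and the set is one orbit. A slope carries the translation over to the second coordinates. -/
theorem exists_grid [Fact p.Prime] (ι : ZMod p →+* K) (h : IsNet p n S) (hp : 7 ≤ p)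
    (hn : 2 ≤ n) (hnp : n ≤ p) :
    n = p ∧ ∃ t u : K, t ≠ 0 ∧ u ≠ 0 ∧
      (∀ x ∈ S.image Prod.fst, ∀ x' ∈ S.image Prod.fst, ∃ i, x' = x + ι i * t) ∧
      (∀ y ∈ S.image Prod.snd, ∀ i, y + ι i * u ∈ S.image Prod.snd) ∧
      ∀ y ∈ S.image Prod.snd, ∀ y' ∈ S.image Prod.snd, ∃ i, y' = y + ι i * u := by
  have hA := h.card_fst (by omega)
  have hB := h.card_snd (by omega)
  obtain ⟨x₀, hx₀, -⟩ := exists_mem_avoiding (S.image Prod.fst) []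
    (by rw [hA, List.length_nil]; omega)
  obtain ⟨x₁, hx₁, hx⟩ := exists_mem_avoiding (S.image Prod.fst) [x₀]
    (by rw [hA, List.length_singleton]; omega)
  obtain ⟨z₀, hz₀, rfl⟩ := Finset.mem_image.1 hx₀
  obtain ⟨z₁, hz₁, rfl⟩ := Finset.mem_image.1 hx₁
  obtain ⟨m, r, hm, hmA, hr⟩ := h.exists_homothety hp hn hz₀
  obtain ⟨-, s, -, -, hs⟩ := h.exists_homothety hp hn hz₁
  obtain ⟨t, ht, htA⟩ := exists_translation (fun h => hx (by simp [h])) hr hs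
  have hpn : n = p := by
    have := (card_le_of_translation ι ht htA hx₀).1
    omega
  have hmt : m * t ≠ 0 := mul_ne_zero hm ht
  have hBt : ∀ y ∈ S.image Prod.snd, y + m * t ∈ S.image Prod.snd := by
    intro y hy
    obtain ⟨x, hx, hxy⟩ := Finset.surj_on_of_inj_on_of_card_le
      (fun x _ => z₀.2 + m * (x - z₀.1)) hmA (fun a b _ _ hab => by simpa [hm] using hab)
      (by rw [hA, hB]) y hy
    have := hmA _ (htA x hx)
    rw [hxy]
    convert this using 1
    ring
  exact ⟨hpn, t, m * t, ht, hmt,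
    fun x hx => (card_le_of_translation ι ht htA hx).2 (hA.trans hpn),
    fun y hy => add_mul_mem ι hBt hy,
    fun y hy => (card_le_of_translation ι hmt hBt hy).2 (hB.trans hpn)⟩

theorem exists_notMem_column (h : IsNet p p S) (hp : 2 ≤ p) {x : K} (hx : x ∈ S.image Prod.fst) :
    ∃ y ∈ S.image Prod.snd, (x, y) ∉ S ∧ ∀ y' ∈ S.image Prod.snd, (x, y') ∉ S → y' = y := by
  obtain ⟨z, hz, rfl⟩ := Finset.mem_image.1 hx
  have h1 := Finset.card_filter_add_card_filter_not (s := S.image Prod.snd)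
    (fun y => (z.1, y) ∈ S)
  have h2 : (S.filter fun w => w.1 = z.1).card =
      ((S.image Prod.snd).filter fun y => (z.1, y) ∈ S).card := by
    refine Finset.card_nbij' Prod.snd (fun y => (z.1, y)) (fun w hw => ?_) (fun y hy => ?_)
      (fun w hw => ?_) fun y hy => rfl
    · simp only [Finset.coe_filter, Set.mem_ofPred_eq] at hw ⊢
      exact ⟨Finset.mem_image_of_mem _ hw.1, by rw [← hw.2]; exact hw.1⟩
    · simp only [Finset.coe_filter, Set.mem_ofPred_eq] at hy ⊢
      exact ⟨hy.2, trivial⟩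
    · simp only [Finset.coe_filter, Set.mem_ofPred_eq] at hw
      exact Prod.ext hw.2.symm rfl
  rw [h.card_snd hp, ← h2, h.column z hz] at h1
  obtain ⟨y, hy⟩ := Finset.card_eq_one.1
    (by omega : ((S.image Prod.snd).filter fun y => (z.1, y) ∉ S).card = 1)
  have hmem := Finset.mem_filter.1 (hy ▸ Finset.mem_singleton_self y)
  exact ⟨y, hmem.1, hmem.2, fun y' hy' hS =>
    Finset.mem_singleton.1 (hy ▸ Finset.mem_filter.2 ⟨hy', hS⟩)⟩

theorem mem_of_row (h : IsNet p p S) (hp : 2 ≤ p) {y : K}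
    (hy : y ∈ S.image Prod.snd) :
    ∃ e, ∀ x ∈ S.image Prod.fst, x ≠ e → (x, y) ∈ S := by
  obtain ⟨z, hz, rfl⟩ := Finset.mem_image.1 hy
  have h1 := Finset.card_filter_add_card_filter_not (s := S.image Prod.fst)
    (fun x => (x, z.2) ∈ S)
  have h2 : (S.filter fun w => w.2 = z.2).card ≤
      ((S.image Prod.fst).filter fun x => (x, z.2) ∈ S).card :=
    Finset.card_le_card_of_injOn Prod.fst
      (fun w hw => by
        simp only [Finset.coe_filter, Set.mem_ofPred_eq] at hw ⊢
        exact ⟨Finset.mem_image_of_mem _ hw.1, by rw [← hw.2]; exact hw.1⟩)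
      fun a ha b hb hab => by
        simp only [Finset.coe_filter, Set.mem_ofPred_eq] at ha hb
        exact Prod.ext hab (ha.2.trans hb.2.symm)
  rw [h.card_fst hp] at h1
  rw [h.row z hz] at h2
  have h3 : ((S.image Prod.fst).filter fun x => (x, z.2) ∉ S).card ≤ 1 := by omega
  obtain ⟨e, he⟩ := Finset.card_le_one_iff_subset_singleton.1 h3
  refine ⟨e, fun x hx hxe => ?_⟩
  by_contra hno
  exact hxe (Finset.mem_singleton.1 (he (Finset.mem_filter.2 ⟨hx, hno⟩)))

/-- Both coordinate sets are orbits of F_p, so the line from z to the hole (x₂, y₂) meets column x₁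
in a grid point. If that point were in S, the net line through it would contain the hole. Hence it
is the unique hole (x₁, y₁) of its column. -/
theorem collinear [Fact p.Prime] (ι : ZMod p →+* K) (h : IsNet p p S) (hp : 7 ≤ p) {z : K × K}
    (hz : z ∈ S) :
    ∃ e, ∀ x₁ ∈ S.image Prod.fst, ∀ x₂ ∈ S.image Prod.fst, ∀ y₁ ∈ S.image Prod.snd,
      ∀ y₂ ∈ S.image Prod.snd, x₁ ≠ z.1 → x₂ ≠ z.1 → x₁ ≠ e → (x₁, y₁) ∉ S → (x₂, y₂) ∉ S →
      (∀ y ∈ S.image Prod.snd, (x₁, y) ∉ S → y = y₁) → (x₂, z.2) ∈ S →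
      (y₂ - z.2) * (x₁ - z.1) = (y₁ - z.2) * (x₂ - z.1) := by
  obtain ⟨e, he⟩ := h.mem_of_line (by omega) hz
  obtain ⟨-, t, u, ht, hu, hA, hB, hB'⟩ := h.exists_grid ι hp (by omega) le_rfl
  refine ⟨e.1, fun x₁ hx₁ x₂ hx₂ y₁ hy₁ y₂ hy₂ hxz₁ hxz₂ hxe h₁ h₂ huniq hz₂ => ?_⟩
  have hzA := Finset.mem_image_of_mem Prod.fst hz
  have hzB := Finset.mem_image_of_mem Prod.snd hz
  obtain ⟨i, hi⟩ := hA _ hzA _ hx₁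
  obtain ⟨j, hj⟩ := hA _ hzA _ hx₂
  obtain ⟨k, hk⟩ := hB' _ hzB _ hy₂
  have hx1 : x₁ - z.1 ≠ 0 := sub_ne_zero.2 hxz₁
  have hx2 : x₂ - z.1 ≠ 0 := sub_ne_zero.2 hxz₂
  have hy2 : y₂ - z.2 ≠ 0 := sub_ne_zero.2 fun h => h₂ (h ▸ hz₂)
  have hj0 : ι j ≠ 0 := fun h => hxz₂ (by rw [hj, h]; ring)
  have hmem := hB _ hzB (k * i / j)
  have hval : z.2 + ι (k * i / j) * u = z.2 + (y₂ - z.2) / (x₂ - z.1) * (x₁ - z.1) := by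
    rw [hi, hj, hk, map_div₀, map_mul]
    field_simp
    ring
  rw [hval] at hmem
  have heq : z.2 + (y₂ - z.2) / (x₂ - z.1) * (x₁ - z.1) = y₁ := by
    refine huniq _ hmem fun hS => h₂ ?_
    have := he _ hS (fun h => hxe (by rw [← h])) hxz₁
      (by simpa using ⟨⟨hy2, hx2⟩, hx1⟩) x₂ hx₂
    convert this using 2
    field_simp
    ring
  rw [← heq]
  field_simp
  ring

/-- Two points of one column would both lie on the line through two holes in other columns. -/
theorem not_isNet [Fact p.Prime] (ι : ZMod p →+* K) (hp : 7 ≤ p) (hn : 2 ≤ n) (hnp : n ≤ p) :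
    ¬ IsNet p n S := by
  intro h
  obtain rfl := (h.exists_grid ι hp hn hnp).1
  have hA := h.card_fst (by omega)
  obtain ⟨x₀, hx₀, -⟩ := exists_mem_avoiding (S.image Prod.fst) []
    (by rw [hA, List.length_nil]; omega)
  obtain ⟨z, hz, hzx, -⟩ := h.exists_mem_column hx₀ [] (by rw [List.length_nil]; omega)
  obtain ⟨z', hz', hzx', hne⟩ := h.exists_mem_column hx₀ [z] (by rw [List.length_singleton]; omega)
  rw [List.mem_singleton] at hne
  obtain ⟨e, he⟩ := h.collinear ι hp hz
  obtain ⟨e', he'⟩ := h.collinear ι hp hz'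
  obtain ⟨f, hf⟩ := h.mem_of_row (by omega) (Finset.mem_image_of_mem Prod.snd hz)
  obtain ⟨f', hf'⟩ := h.mem_of_row (by omega) (Finset.mem_image_of_mem Prod.snd hz')
  obtain ⟨x₁, hx₁, h₁⟩ := exists_mem_avoiding (S.image Prod.fst) [x₀, e, e', f, f']
    (by rw [hA]; simp only [List.length_cons, List.length_nil]; omega)
  obtain ⟨x₂, hx₂, h₂⟩ := exists_mem_avoiding (S.image Prod.fst) [x₀, x₁, f, f']
    (by rw [hA]; simp only [List.length_cons, List.length_nil]; omega)
  simp only [List.mem_cons, List.not_mem_nil, or_false, not_or] at h₁ h₂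
  obtain ⟨y₁, hy₁, hS₁, huniq⟩ := h.exists_notMem_column (by omega) hx₁
  obtain ⟨y₂, hy₂, hS₂, -⟩ := h.exists_notMem_column (by omega) hx₂
  have hl := he x₁ hx₁ x₂ hx₂ y₁ hy₁ y₂ hy₂ (hzx ▸ h₁.1) (hzx ▸ h₂.1) h₁.2.1 hS₁ hS₂ huniq
    (hf _ hx₂ h₂.2.2.1)
  have hl' := he' x₁ hx₁ x₂ hx₂ y₁ hy₁ y₂ hy₂ (hzx' ▸ h₁.1) (hzx' ▸ h₂.1) h₁.2.2.1 hS₁ hS₂ huniq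
    (hf' _ hx₂ h₂.2.2.2)
  rw [hzx] at hl
  rw [hzx'] at hl'
  have : (z'.2 - z.2) * (x₁ - x₂) = 0 := by linear_combination hl - hl'
  obtain h3 | h3 := mul_eq_zero.1 this
  · exact hne (Prod.ext (hzx'.trans hzx.symm) (sub_eq_zero.1 h3))
  · exact h₂.2.1 (sub_eq_zero.1 h3).symm

end IsNet

end AffineNet

/-! ### Affine coordinates -/

section Coordinates

open Projectivization

variable {K : Type*} [Field K]

/-- Affine coordinates on the complement of a line, with the coordinate directions given by two
points of that line. -/
theorem exists_coordinates {P Q m : ℙ K (Fin 3 → K)} (hPQ : P ≠ Q) (hP : P ∈ m) (hQ : Q ∈ m) :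
    ∃ φ : K × K → ℙ K (Fin 3 → K), Function.Injective φ ∧ (∀ z, z ∉ m ↔ ∃ w, φ w = z) ∧
      ∀ l : ℙ K (Fin 3 → K), ∃ α β γ : K, (∀ w, φ w ∈ l ↔ α + w.1 * β + w.2 * γ = 0) ∧
        (P ∈ l ↔ β = 0) ∧ (Q ∈ l ↔ γ = 0) := by
  obtain ⟨O, hO⟩ := exists_not_orthogonal_self m
  induction P with | h u hu =>
  induction Q with | h v hv =>
  induction m with | h n hn =>
  induction O with | h o ho =>
  rw [ofField.mem_iff, orthogonal_mk hu hn] at hP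
  rw [ofField.mem_iff, orthogonal_mk hv hn] at hQ
  rw [orthogonal_mk ho hn] at hO
  have hdot : ∀ x y : K, (o + x • u + y • v) ⬝ᵥ n = o ⬝ᵥ n := by
    intro x y
    rw [add_dotProduct, add_dotProduct, smul_dotProduct, smul_dotProduct, hP, hQ]
    simp
  have hne : ∀ x y : K, o + x • u + y • v ≠ 0 := by
    intro x y h0
    rw [← hdot x y, h0, zero_dotProduct] at hO
    exact hO rfl
  have hlin : LinearIndependent K ![u, v] := by
    rw [LinearIndependent.pair_iff' hu]
    intro a ha
    exact hPQ ((mk_eq_mk_iff' K u v hu hv).2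
      ⟨a⁻¹, by rw [← ha, inv_smul_smul₀]; rintro rfl; exact hv (by rw [← ha, zero_smul])⟩)
  have hlin3 : LinearIndependent K ![o, u, v] := by
    refine linearIndependent_finCons.2 ⟨hlin, fun hmem => hO ?_⟩
    rw [Matrix.range_cons, Matrix.range_cons, Matrix.range_empty, Set.union_empty,
      Set.singleton_union, Submodule.mem_span_pair] at hmem
    obtain ⟨a, b, rfl⟩ := hmem
    rw [add_dotProduct, smul_dotProduct, smul_dotProduct, hP, hQ]
    simp
  refine ⟨fun w => mk K (o + w.1 • u + w.2 • v) (hne _ _), fun w w' hww => ?_, fun z => ?_,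
    fun l => ?_⟩
  · obtain ⟨a, ha⟩ := (mk_eq_mk_iff' K _ _ (hne _ _) (hne _ _)).1 hww
    have h1 : a = 1 := by
      have := congrArg (· ⬝ᵥ n) ha
      simp only [smul_dotProduct, hdot, smul_eq_mul] at this
      exact mul_right_cancel₀ hO (this.trans (one_mul _).symm)
    rw [h1, one_smul] at ha
    have h2 := LinearIndependent.pair_iff.1 hlin (w'.1 - w.1) (w'.2 - w.2) (by
      rw [sub_smul, sub_smul]
      linear_combination (exp := 1) ha)
    exact Prod.ext (sub_eq_zero.1 h2.1).symm (sub_eq_zero.1 h2.2).symm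
  · induction z with | h z hz =>
    rw [ofField.mem_iff, orthogonal_mk hz hn]
    constructor
    · intro hzn
      have hspan := hlin3.span_eq_top_of_card_eq_finrank (by simp)
      have hmem : z ∈ Submodule.span K (Set.range ![o, u, v]) := hspan ▸ Submodule.mem_top
      rw [Matrix.range_cons, Matrix.range_cons, Matrix.range_cons, Matrix.range_empty,
        Set.union_empty, Set.singleton_union, Set.singleton_union,
        Submodule.mem_span_triple] at hmem
      obtain ⟨a, b, c, rfl⟩ := hmem
      have ha : a ≠ 0 := by
        rintro rfl
        apply hzn
        rw [add_dotProduct, add_dotProduct, smul_dotProduct, smul_dotProduct, smul_dotProduct, hP,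
          hQ]
        simp
      refine ⟨(a⁻¹ * b, a⁻¹ * c), (mk_eq_mk_iff' K _ _ (hne _ _) hz).2 ⟨a⁻¹, ?_⟩⟩
      rw [smul_add, smul_add, smul_smul, smul_smul, smul_smul, inv_mul_cancel₀ ha, one_smul]
    · rintro ⟨w, hw⟩
      obtain ⟨a, ha⟩ := (mk_eq_mk_iff' K _ _ (hne _ _) hz).1 hw
      intro h0
      have := congrArg (· ⬝ᵥ n) ha
      simp only [smul_dotProduct, hdot, h0, smul_zero] at this
      exact hO this.symm
  · induction l with | h l hl =>
    refine ⟨o ⬝ᵥ l, u ⬝ᵥ l, v ⬝ᵥ l, fun w => ?_, ?_, ?_⟩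
    · rw [ofField.mem_iff, orthogonal_mk (hne _ _) hl, add_dotProduct, add_dotProduct,
        smul_dotProduct, smul_dotProduct, smul_eq_mul, smul_eq_mul]
    · rw [ofField.mem_iff, orthogonal_mk hu hl]
    · rw [ofField.mem_iff, orthogonal_mk hv hl]

end Coordinates

/-! ### From plane-like and antipodal sets to nets -/

section Nets

variable {K : Type*} [Field K]

theorem card_inter_le_one (X : Finset (ℙ K (Fin 3 → K))) {l m : ℙ K (Fin 3 → K)} (hlm : l ≠ m) :
    (X.filter fun z => z ∈ l ∧ z ∈ m).card ≤ 1 := by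
  refine Finset.card_le_one.2 fun a ha b hb => ?_
  rw [Finset.mem_filter] at ha hb
  exact (Nondegenerate.eq_or_eq ha.2.1 hb.2.1 ha.2.2 hb.2.2).resolve_right hlm

theorem onLine_eq_add (X : Finset (ℙ K (Fin 3 → K))) (l m : ℙ K (Fin 3 → K)) :
    onLine X l = (X.filter fun z => z ∈ l ∧ z ∈ m).card +
      (X.filter fun z => z ∈ l ∧ z ∉ m).card := by
  rw [onLine, ← Finset.card_filter_add_card_filter_not (fun z => z ∈ m), Finset.filter_filter,
    Finset.filter_filter]

/-- With m at infinity, the lines through P become the rows and those through Q the columns. Each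
has p points of X, one of them on m, which leaves p - 1. -/
theorem exists_isNet [Fintype K] {p n : ℕ} {X : Finset (ℙ K (Fin 3 → K))} {P Q m : ℙ K (Fin 3 → K)}
    (hPQ : P ≠ Q) (hPX : P ∈ X) (hQX : Q ∈ X) (hPm : P ∈ m) (hQm : Q ∈ m)
    (hcard : X.card = n * (p - 1) + onLine X m)
    (hpencil : ∀ l ≠ m, P ∈ l ∨ Q ∈ l → 2 ≤ onLine X l → onLine X l = p)
    (hline : ∀ z ∈ X, z ∉ m → ∃ e, ∀ z' ∈ X, z' ≠ e → z' ≠ z → ∀ l ≠ m, P ∉ l → Q ∉ l →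
      z ∈ l → z' ∈ l → n ≤ (X.filter fun z => z ∈ l ∧ z ∉ m).card) :
    ∃ S : Finset (K × K), IsNet p n S := by
  obtain ⟨φ, hinj, hφ, hcoord⟩ := exists_coordinates hPQ hPm hQm
  have hφm : ∀ w, φ w ∉ m := fun w => (hφ _).2 ⟨w, rfl⟩
  have hcount : ∀ l : ℙ K (Fin 3 → K),
      ((Finset.univ.filter fun w => φ w ∈ X).filter fun w => φ w ∈ l).card =
      (X.filter fun z => z ∈ l ∧ z ∉ m).card := by
    intro l
    rw [← Finset.card_image_of_injective _ hinj]
    congr 1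
    ext z
    simp only [Finset.mem_image, Finset.mem_filter, Finset.mem_univ, true_and]
    constructor
    · rintro ⟨w, ⟨hw, hwl⟩, rfl⟩
      exact ⟨hw, hwl, hφm w⟩
    · rintro ⟨hz, hzl, hzm⟩
      obtain ⟨w, rfl⟩ := (hφ z).1 hzm
      exact ⟨w, ⟨hz, hzl⟩, rfl⟩
  have hnot : ∀ l : ℙ K (Fin 3 → K), l ≠ m → P ∈ l → Q ∉ l := fun l hl h1 h2 =>
    hl ((Nondegenerate.eq_or_eq h1 h2 hPm hQm).resolve_left hPQ)
  have hthrough : ∀ w, φ w ∈ X → ∀ R ∈ X, R ∈ m → (R = P ∨ R = Q) →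
      ∀ l : ℙ K (Fin 3 → K), R ∈ l → φ w ∈ l →
      ((Finset.univ.filter fun w => φ w ∈ X).filter fun w => φ w ∈ l).card = p - 1 := by
    intro w hw R hR hRm hRPQ l hRl hwl
    have hlm : l ≠ m := fun h => hφm w (h ▸ hwl)
    have h1 : 2 ≤ onLine X l := Finset.one_lt_card.2
      ⟨R, Finset.mem_filter.2 ⟨hR, hRl⟩, φ w, Finset.mem_filter.2 ⟨hw, hwl⟩,
        fun h => hφm w (h ▸ hRm)⟩
    have h2 := hpencil l hlm (by obtain rfl | rfl := hRPQ <;> simp [hRl]) h1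
    have h3 := card_inter_le_one X hlm
    have h4 : 0 < (X.filter fun z => z ∈ l ∧ z ∈ m).card :=
      Finset.card_pos.2 ⟨R, Finset.mem_filter.2 ⟨hR, hRl, hRm⟩⟩
    rw [hcount]
    rw [onLine_eq_add X l m] at h2
    omega
  refine ⟨Finset.univ.filter fun w => φ w ∈ X, ?_, fun z hz => ?_, fun z hz => ?_, fun z hz => ?_⟩
  · rw [← Finset.card_image_of_injective _ hinj]
    have h1 : (Finset.univ.filter fun w => φ w ∈ X).image φ = X.filter fun z => z ∉ m := by
      ext z
      simp only [Finset.mem_image, Finset.mem_filter, Finset.mem_univ, true_and]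
      constructor
      · rintro ⟨w, hw, rfl⟩
        exact ⟨hw, hφm w⟩
      · rintro ⟨hz, hzm⟩
        obtain ⟨w, rfl⟩ := (hφ z).1 hzm
        exact ⟨w, hz, rfl⟩
    have h2 := Finset.card_filter_add_card_filter_not (s := X) (fun z => z ∈ m)
    rw [onLine] at hcard
    rw [h1]
    omega
  · have hzX : φ z ∈ X := (Finset.mem_filter.1 hz).2
    have hne : Q ≠ φ z := fun h => hφm z (h ▸ hQm)
    obtain ⟨hl1, hl2⟩ := HasLines.mkLine_ax (L := ℙ K (Fin 3 → K)) hne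
    generalize HasLines.mkLine (L := ℙ K (Fin 3 → K)) hne = l at hl1 hl2
    rw [← hthrough z hzX Q hQX hQm (Or.inr rfl) l hl1 hl2]
    congr 1
    refine Finset.filter_congr fun w _ => ?_
    obtain ⟨α, β, γ, hlw, hlP, hlQ⟩ := hcoord l
    have hβ : β ≠ 0 := fun h =>
      hnot l (fun h => hφm z (h ▸ hl2)) (hlP.2 h) hl1
    have h1 := (hlw z).1 hl2
    rw [hlw, hlQ.1 hl1]
    rw [hlQ.1 hl1] at h1
    constructor
    · intro h
      rw [h]
      linear_combination h1
    · intro h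
      refine mul_right_cancel₀ hβ ?_
      linear_combination h - h1
  · have hzX : φ z ∈ X := (Finset.mem_filter.1 hz).2
    have hne : P ≠ φ z := fun h => hφm z (h ▸ hPm)
    obtain ⟨hl1, hl2⟩ := HasLines.mkLine_ax (L := ℙ K (Fin 3 → K)) hne
    generalize HasLines.mkLine (L := ℙ K (Fin 3 → K)) hne = l at hl1 hl2
    rw [← hthrough z hzX P hPX hPm (Or.inl rfl) l hl1 hl2]
    congr 1
    refine Finset.filter_congr fun w _ => ?_
    obtain ⟨α, β, γ, hlw, hlP, hlQ⟩ := hcoord l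
    have hγ : γ ≠ 0 := fun h =>
      hnot l (fun h => hφm z (h ▸ hl2)) hl1 (hlQ.2 h)
    have h1 := (hlw z).1 hl2
    rw [hlw, hlP.1 hl1]
    rw [hlP.1 hl1] at h1
    constructor
    · intro h
      rw [h]
      linear_combination h1
    · intro h
      refine mul_right_cancel₀ hγ ?_
      linear_combination h - h1
  · have hzX : φ z ∈ X := (Finset.mem_filter.1 hz).2
    obtain ⟨e₀, he₀⟩ := hline _ hzX (hφm z)
    obtain ⟨e, he⟩ : ∃ e, ∀ z', z' ≠ e → φ z' ≠ e₀ := by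
      by_cases h : ∃ w, φ w = e₀
      · obtain ⟨w, rfl⟩ := h
        exact ⟨w, fun z' hz' h => hz' (hinj h)⟩
      · exact ⟨z, fun z' _ h' => h ⟨z', h'⟩⟩
    refine ⟨e, fun z' hz' hze h1 h2 => ?_⟩
    have hzX' : φ z' ∈ X := (Finset.mem_filter.1 hz').2
    have hne : φ z' ≠ φ z := fun h => h1 (by rw [hinj h])
    obtain ⟨hl1, hl2⟩ := HasLines.mkLine_ax (L := ℙ K (Fin 3 → K)) hne
    generalize HasLines.mkLine (L := ℙ K (Fin 3 → K)) hne = l at hl1 hl2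
    have hlm : l ≠ m := fun h => hφm z (h ▸ hl2)
    obtain ⟨α, β, γ, hlw, hlP, hlQ⟩ := hcoord l
    have h3 := (hlw z').1 hl1
    have h4 := (hlw z).1 hl2
    have h5 : (z'.1 - z.1) * β + (z'.2 - z.2) * γ = 0 := by linear_combination h3 - h4
    have hβ : β ≠ 0 := by
      intro h
      rw [h, mul_zero, zero_add] at h5
      exact hnot l hlm (hlP.2 h) (hlQ.2 ((mul_eq_zero.1 h5).resolve_left (sub_ne_zero.2 h2)))
    have hγ : γ ≠ 0 := by
      intro h
      rw [h, mul_zero, add_zero] at h5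
      exact hβ ((mul_eq_zero.1 h5).resolve_left (sub_ne_zero.2 h1))
    refine (he₀ _ hzX' (he z' hze) hne l hlm (fun h => hβ (hlP.1 h)) (fun h => hγ (hlQ.1 h))
      hl2 hl1).trans ?_
    rw [← hcount]
    refine Finset.card_le_card (Finset.monotone_filter_right _ fun w _ hwl => ?_)
    have h6 := (hlw w).1 hwl
    refine mul_right_cancel₀ hβ ?_
    linear_combination (w.2 - z.2) * h5 - (z'.2 - z.2) * (h6 - h4)

/-- Any secant can serve as m. It leaves (p - 1)² affine points, and another secant loses at most
one point on m, so n = p - 1. -/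
theorem not_planeLike {p : ℕ} [Fact p.Prime] (ι : ZMod p →+* K) [Fintype K] (hp : 7 ≤ p)
    (X : Finset (ℙ K (Fin 3 → K))) : ¬ PlaneLike (ℙ K (Fin 3 → K)) p X := by
  rintro ⟨hX, hl⟩
  have hpp : p ^ 2 + 1 = p + ((p - 1) * (p - 1) + p) := by
    obtain ⟨r, rfl⟩ : ∃ r, p = r + 1 := ⟨p - 1, by omega⟩
    rw [Nat.add_sub_cancel]
    ring
  obtain ⟨P, hP, Q, hQ, hPQ⟩ := Finset.one_lt_card.1 (by omega : 1 < X.card)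
  obtain ⟨hPm, hQm⟩ := HasLines.mkLine_ax (L := ℙ K (Fin 3 → K)) hPQ
  generalize HasLines.mkLine (L := ℙ K (Fin 3 → K)) hPQ = m at hPm hQm
  have htwo : ∀ {a b l : ℙ K (Fin 3 → K)}, a ∈ X → b ∈ X → a ≠ b → a ∈ l → b ∈ l →
      onLine X l = p := fun ha hb hab hal hbl =>
    hl _ (Finset.one_lt_card.2
      ⟨_, Finset.mem_filter.2 ⟨ha, hal⟩, _, Finset.mem_filter.2 ⟨hb, hbl⟩, hab⟩)
  obtain ⟨S, hS⟩ := exists_isNet (p := p) (n := p - 1) hPQ hP hQ hPm hQm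
    (by rw [htwo hP hQ hPQ hPm hQm]; omega) (fun l _ _ h => hl l h)
    fun z hz _ => ⟨P, fun z' hz' _ hzz l hlm _ _ hzl hzl' => by
      have h1 := htwo hz' hz hzz hzl' hzl
      have h2 := card_inter_le_one X hlm
      rw [onLine_eq_add X l m] at h1
      omega⟩
  exact IsNet.not_isNet ι hp (by omega) (by omega) hS

/-- Here m is a two-point secant, so p(p - 1) affine points remain. Secants avoiding P and Q lose no
point, so n = p. The exceptional point for z is its partner on the two-point secant through z. -/
theorem not_antipodalLike {p : ℕ} [Fact p.Prime] (ι : ZMod p →+* K) [Fintype K] (hp : 7 ≤ p)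
    (X : Finset (ℙ K (Fin 3 → K))) : ¬ AntipodalLike (ℙ K (Fin 3 → K)) p X := by
  rintro ⟨hX, hl, huniq⟩
  have hpp : p ^ 2 = p + p * (p - 1) := by
    obtain ⟨r, rfl⟩ : ∃ r, p = r + 1 := ⟨p - 1, by omega⟩
    rw [Nat.add_sub_cancel]
    ring
  obtain ⟨x, hx⟩ := Finset.card_pos.1 (by omega : 0 < X.card)
  obtain ⟨m, ⟨-, hm⟩, -⟩ := huniq x hx
  obtain ⟨P, Q, hPQ, hmX⟩ := Finset.card_eq_two.1 (show (X.filter fun z => z ∈ m).card = 2 from hm)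
  have hmem : ∀ z, z ∈ X ∧ z ∈ m ↔ z = P ∨ z = Q := fun z => by
    rw [← Finset.mem_filter, hmX]
    simp
  obtain ⟨hP, hPm⟩ := (hmem P).2 (Or.inl rfl)
  obtain ⟨hQ, hQm⟩ := (hmem Q).2 (Or.inr rfl)
  obtain ⟨S, hS⟩ := exists_isNet (p := p) (n := p) hPQ hP hQ hPm hQm
    (by rw [hm]; omega)
    (fun l hlm hPQl h => (hl l h).resolve_right fun h2 => hlm <| by
      obtain h3 | h3 := hPQl
      · exact (huniq P hP).unique ⟨h3, h2⟩ ⟨hPm, hm⟩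
      · exact (huniq Q hQ).unique ⟨h3, h2⟩ ⟨hQm, hm⟩)
    fun z hz hzm => by
      obtain ⟨l₀, ⟨hzl₀, hl₀⟩, hu⟩ := huniq z hz
      obtain ⟨e, he⟩ := Finset.card_eq_one.1 (show
        ((X.filter fun z => z ∈ l₀).erase z).card = 1 by
          rw [Finset.card_erase_of_mem (Finset.mem_filter.2 ⟨hz, hzl₀⟩),
            show (X.filter fun z => z ∈ l₀).card = 2 from hl₀])
      refine ⟨e, fun z' hz' hze hzz l hlm hPl hQl hzl hzl' => ?_⟩
      have h1 := hl l (Finset.one_lt_card.2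
        ⟨_, Finset.mem_filter.2 ⟨hz', hzl'⟩, _, Finset.mem_filter.2 ⟨hz, hzl⟩, hzz⟩)
      have h2 : onLine X l = p := h1.resolve_right fun h2 => hze <| by
        rw [hu l ⟨hzl, h2⟩] at hzl'
        rw [← Finset.mem_singleton, ← he]
        exact Finset.mem_erase.2 ⟨hzz, Finset.mem_filter.2 ⟨hz', hzl'⟩⟩
      rw [← h2, onLine]
      refine Finset.card_le_card fun y hy => ?_
      rw [Finset.mem_filter] at hy ⊢
      refine ⟨hy.1, hy.2, fun hym => ?_⟩
      obtain rfl | rfl := (hmem y).1 ⟨hy.1, hym⟩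
      · exact hPl hy.2
      · exact hQl hy.2
  exact IsNet.not_isNet ι hp (by omega) le_rfl hS

end Nets

/-! ### A word of weight at most 2p² - p -/

section UpperBound

open Projectivization

variable {K : Type*} [Field K] {p : ℕ} [Fact p.Prime]

theorem mem_dualCode_code_iff {P L : Type*} [Fintype P] [Membership P L] {v : P → ZMod p} :
    v ∈ dualCode (code p P L) ↔ ∀ l : L, ∑ z with z ∈ l, v z = 0 := by
  have hrow : ∀ l : L, v ⬝ᵥ (incidenceMatrix (ZMod p) P L).row l = ∑ z with z ∈ l, v z := by
    intro l
    simp [dotProduct, incidenceMatrix, Matrix.row, Finset.sum_filter]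
  constructor
  · intro hv l
    rw [← hrow]
    exact hv _ (Submodule.subset_span ⟨l, rfl⟩)
  · intro hv w hw
    induction hw using Submodule.span_induction with
    | mem x hx =>
      obtain ⟨l, rfl⟩ := hx
      rw [hrow, hv]
    | zero => exact dotProduct_zero v
    | add x y _ _ hx hy => rw [dotProduct_add, hx, hy, add_zero]
    | smul a x _ hx => rw [dotProduct_smul, hx, smul_zero]

/-- The affine point with coordinates in the prime field. -/
def subplanePoint (ι : ZMod p →+* K) (w : ZMod p × ZMod p) : ℙ K (Fin 3 → K) :=
  mk K ![ι w.1, ι w.2, 1] fun h => one_ne_zero (congrFun h 2)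

/-- The point at infinity with slope `a`. -/
def directionPoint (a : K) : ℙ K (Fin 3 → K) :=
  mk K ![1, a, 0] fun h => one_ne_zero (congrFun h 0)

theorem subplanePoint_injective (ι : ZMod p →+* K) : Function.Injective (subplanePoint ι) := by
  intro w w' h
  obtain ⟨a, ha⟩ := (mk_eq_mk_iff' K _ _ _ _).1 h
  have h2 := congrFun ha 2
  have h1 := congrFun ha 1
  have h0 := congrFun ha 0
  simp at h0 h1 h2
  subst h2
  simp only [one_mul] at h0 h1
  exact Prod.ext (ι.injective h0).symm (ι.injective h1).symm

theorem directionPoint_injective : Function.Injective (directionPoint (K := K)) := by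
  intro w w' h
  obtain ⟨a, ha⟩ := (mk_eq_mk_iff' K _ _ _ _).1 h
  have h1 := congrFun ha 1
  have h0 := congrFun ha 0
  simp at h0 h1
  subst h0
  rw [one_mul] at h1
  exact h1.symm

theorem subplanePoint_mem (ι : ZMod p →+* K) (w : ZMod p × ZMod p) {l : Fin 3 → K} (hl : l ≠ 0) :
    subplanePoint ι w ∈ mk K l hl ↔ ι w.1 * l 0 + ι w.2 * l 1 + l 2 = 0 := by
  rw [ofField.mem_iff, subplanePoint, orthogonal_mk _ hl]
  simp [dotProduct, Fin.sum_univ_three]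

theorem directionPoint_mem (a : K) {l : Fin 3 → K} (hl : l ≠ 0) :
    directionPoint a ∈ mk K l hl ↔ l 0 + a * l 1 = 0 := by
  rw [ofField.mem_iff, directionPoint, orthogonal_mk _ hl]
  simp [dotProduct, Fin.sum_univ_three]

theorem subplanePoint_ne_directionPoint (ι : ZMod p →+* K) (w : ZMod p × ZMod p) (a : K) :
    subplanePoint ι w ≠ directionPoint a := by
  intro h
  obtain ⟨b, hb⟩ := (mk_eq_mk_iff' K _ _ _ _).1 h
  simpa using congrFun hb 2

variable [Fintype K]

theorem card_notMem_range (ι : ZMod p →+* K) (hK : Fintype.card K = p ^ 2) :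
    (Finset.univ.filter fun a : K => a ∉ Set.range ι).card = p ^ 2 - p := by
  have : (Finset.univ.filter fun a : K => a ∈ Set.range ι) = Finset.univ.image ι := by
    ext
    simp
  rw [Finset.filter_not, Finset.card_sdiff_of_subset (Finset.filter_subset _ _), Finset.card_univ,
    hK, this, Finset.card_image_of_injective _ ι.injective, Finset.card_univ, ZMod.card]

/-- The numbers of affine subplane points, respectively of points at infinity whose slope is not in
the prime field, on a line are congruent modulo `p`. -/
theorem card_congr (ι : ZMod p →+* K) (hK : Fintype.card K = p ^ 2) (l : Fin 3 → K) :
    ((Finset.univ.filter fun w : ZMod p × ZMod p =>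
      ι w.1 * l 0 + ι w.2 * l 1 + l 2 = 0).card : ZMod p) =
    ((Finset.univ.filter fun a : K => l 0 + a * l 1 = 0 ∧ a ∉ Set.range ι).card : ZMod p) := by
  by_cases h1 : l 1 = 0
  · have hleft : (Finset.univ.filter fun w : ZMod p × ZMod p =>
        ι w.1 * l 0 + ι w.2 * l 1 + l 2 = 0) =
        (Finset.univ.filter fun x : ZMod p => ι x * l 0 + l 2 = 0) ×ˢ Finset.univ := by
      ext w
      simp [h1]
    rw [hleft, Finset.card_product, Finset.card_univ, ZMod.card, Nat.cast_mul,
      CharP.cast_eq_zero (ZMod p) p, mul_zero]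
    by_cases h0 : l 0 = 0
    -- The line at infinity carries all p² - p exceptional directions, a multiple of p.
    · have hright : (Finset.univ.filter fun a : K => l 0 + a * l 1 = 0 ∧ a ∉ Set.range ι) =
          Finset.univ.filter fun a : K => a ∉ Set.range ι := by
        simp [h0, h1]
      rw [hright, card_notMem_range ι hK, Nat.cast_sub (by rw [sq]; exact Nat.le_mul_self p)]
      simp
    · rw [Finset.filter_false_of_mem fun a _ h => h0 (by simpa [h1] using h.1)]
      simp
  · have hslope : ∀ a : K, l 0 + a * l 1 = 0 ↔ a = -l 0 / l 1 := fun a => by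
      rw [eq_div_iff h1, eq_neg_iff_add_eq_zero, add_comm]
    by_cases hr : -l 0 / l 1 ∈ Set.range ι
    · rw [Finset.filter_false_of_mem (s := (Finset.univ : Finset K))
        fun a _ h => h.2 ((hslope a).1 h.1 ▸ hr), Finset.card_empty, Nat.cast_zero]
      obtain ⟨a, ha⟩ := hr
      have h0 : l 0 = -(ι a * l 1) := by
        rw [ha]
        field_simp
      by_cases hd : ∃ d, ι d = -l 2 / l 1
      · obtain ⟨d, hd⟩ := hd
        have hleft : (Finset.univ.filter fun w : ZMod p × ZMod p =>
            ι w.1 * l 0 + ι w.2 * l 1 + l 2 = 0) =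
            Finset.univ.image fun x => (x, a * x + d) := by
          ext ⟨x, y⟩
          have h2 : l 2 = -(ι d * l 1) := by
            rw [hd]
            field_simp
          simp only [Finset.mem_filter, Finset.mem_univ, true_and, Finset.mem_image, Prod.mk.injEq,
            exists_eq_left]
          rw [← ι.injective.eq_iff, map_add, map_mul, h0, h2]
          constructor
          · intro h
            refine mul_right_cancel₀ h1 ?_
            linear_combination -h
          · intro h
            rw [← h]
            ring
        rw [hleft, Finset.card_image_of_injective _ fun x y h => (Prod.ext_iff.1 h).1,
          Finset.card_univ, ZMod.card, CharP.cast_eq_zero]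
      · rw [Finset.filter_false_of_mem fun w _ h => hd ⟨w.2 - a * w.1, ?_⟩]
        · simp
        · rw [eq_div_iff h1, map_sub, map_mul]
          rw [h0] at h
          linear_combination h
    · have hright : (Finset.univ.filter fun a : K => l 0 + a * l 1 = 0 ∧ a ∉ Set.range ι) =
          {-l 0 / l 1} := by
        ext a
        rw [Finset.mem_filter, Finset.mem_singleton, hslope]
        exact ⟨fun h => h.2.1, fun h => ⟨Finset.mem_univ _, h, h ▸ hr⟩⟩
      -- For a slope outside F_p the coefficients l 0 and l 1 are independent over F_p. By
      -- cardinality the map is then bijective onto K, so the line has exactly one point over F_p.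
      have hinj : Function.Injective fun w : ZMod p × ZMod p => ι w.1 * l 0 + ι w.2 * l 1 := by
        intro w w' h
        have h2 : ι (w.1 - w'.1) * l 0 + ι (w.2 - w'.2) * l 1 = 0 := by
          rw [map_sub, map_sub]
          linear_combination h
        have h3 : w.1 - w'.1 = 0 := by
          by_contra h3
          have h4 : ι (w.1 - w'.1) ≠ 0 := (map_ne_zero ι).2 h3
          refine hr ⟨(w.2 - w'.2) / (w.1 - w'.1), ?_⟩
          rw [map_div₀]
          field_simp
          linear_combination h2
        rw [h3, map_zero, zero_mul, zero_add] at h2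
        have h4 := (map_eq_zero ι).1 ((mul_eq_zero.1 h2).resolve_right h1)
        exact Prod.ext (sub_eq_zero.1 h3) (sub_eq_zero.1 h4)
      obtain ⟨w₀, hw₀⟩ := ((Fintype.bijective_iff_injective_and_card _).2
        ⟨hinj, by rw [Fintype.card_prod, ZMod.card, hK, sq]⟩).2 (-l 2)
      replace hw₀ : ι w₀.1 * l 0 + ι w₀.2 * l 1 = -l 2 := hw₀
      have hleft : (Finset.univ.filter fun w : ZMod p × ZMod p =>
          ι w.1 * l 0 + ι w.2 * l 1 + l 2 = 0) = {w₀} := by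
        ext w
        rw [Finset.mem_filter, Finset.mem_singleton, ← hinj.eq_iff, hw₀]
        exact (and_iff_right (Finset.mem_univ _)).trans eq_neg_iff_add_eq_zero.symm
      rw [hleft, hright, Finset.card_singleton, Finset.card_singleton]

theorem exists_mem_dualCode [Fintype (ℙ K (Fin 3 → K))] (ι : ZMod p →+* K)
    (hK : Fintype.card K = p ^ 2) :
    ∃ c ∈ dualCode (desarguesianCode p K), c ≠ 0 ∧ hammingNorm c ≤ 2 * p ^ 2 - p := by
  obtain ⟨U, hU⟩ : ∃ U : Finset (ℙ K (Fin 3 → K)), U = Finset.univ.image (subplanePoint ι) :=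
    ⟨_, rfl⟩
  obtain ⟨V, hV⟩ : ∃ V : Finset (ℙ K (Fin 3 → K)),
    V = (Finset.univ.filter fun a : K => a ∉ Set.range ι).image directionPoint := ⟨_, rfl⟩
  have hdisj : ∀ z ∈ U, z ∉ V := by
    intro z hz hz'
    rw [hU, Finset.mem_image] at hz
    rw [hV, Finset.mem_image] at hz'
    obtain ⟨w, -, rfl⟩ := hz
    obtain ⟨a, -, ha⟩ := hz'
    exact subplanePoint_ne_directionPoint ι w a ha.symm
  have hUcard : U.card = p ^ 2 := by
    rw [hU, Finset.card_image_of_injective _ (subplanePoint_injective ι), Finset.card_univ,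
      Fintype.card_prod, ZMod.card, sq]
  have hVcard : V.card = p ^ 2 - p := by
    rw [hV, Finset.card_image_of_injective _ directionPoint_injective, card_notMem_range ι hK]
  have hp2 : p ≤ p ^ 2 := by
    rw [sq]
    exact Nat.le_mul_self p
  refine ⟨fun z => (if z ∈ U then 1 else 0) - (if z ∈ V then 1 else 0), ?_, fun h => ?_, ?_⟩
  · rw [mem_dualCode_code_iff]
    intro l
    induction l with | h l hl =>
    rw [Finset.sum_sub_distrib, Finset.sum_boole, Finset.sum_boole, sub_eq_zero]
    convert card_congr ι hK l using 2
    · rw [← Finset.card_image_of_injective _ (subplanePoint_injective ι)]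
      congr 1
      ext z
      simp only [Finset.mem_filter, Finset.mem_univ, true_and, Finset.mem_image, hU]
      constructor
      · rintro ⟨hz, w, rfl⟩
        exact ⟨w, (subplanePoint_mem ι w hl).1 hz, rfl⟩
      · rintro ⟨w, hw, rfl⟩
        exact ⟨(subplanePoint_mem ι w hl).2 hw, w, rfl⟩
    · rw [← Finset.card_image_of_injective _ (directionPoint_injective (K := K))]
      congr 1
      ext z
      simp only [Finset.mem_filter, Finset.mem_univ, true_and, Finset.mem_image, hV]
      constructor
      · rintro ⟨hz, a, ha, rfl⟩
        exact ⟨a, ⟨(directionPoint_mem a hl).1 hz, ha⟩, rfl⟩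
      · rintro ⟨a, ⟨ha, ha'⟩, rfl⟩
        exact ⟨(directionPoint_mem a hl).2 ha, a, ha', rfl⟩
  · have h0 : subplanePoint ι 0 ∈ U := hU ▸ Finset.mem_image_of_mem _ (Finset.mem_univ _)
    have := congrFun h (subplanePoint ι 0)
    simp only [h0, hdisj _ h0, if_true, if_false, sub_zero, Pi.zero_apply] at this
    exact one_ne_zero this
  · have h1 : hammingNorm (fun z => ((if z ∈ U then 1 else 0) -
        (if z ∈ V then 1 else 0) : ZMod p)) ≤ (U ∪ V).card := by
      refine Finset.card_le_card fun z hz => ?_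
      rw [Finset.mem_union]
      by_contra! hno
      simp [hno.1, hno.2] at hz
    have h2 := Finset.card_union_le U V
    omega

end UpperBound

/-! ### Assembly of the two bounds -/

theorem order_eq {K : Type*} [Field K] [Finite K] [Fintype (ℙ K (Fin 3 → K))] :
    ProjectivePlane.order (ℙ K (Fin 3 → K)) (ℙ K (Fin 3 → K)) = Nat.card K := by
  have h1 := ProjectivePlane.card_points (ℙ K (Fin 3 → K)) (ℙ K (Fin 3 → K))
  have h2 := Projectivization.card_of_finrank K (Fin 3 → K) (n := 3) (by simp)
  rw [← Nat.card_eq_fintype_card, h2] at h1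
  simp only [Finset.sum_range_succ, Finset.sum_range_zero] at h1
  nlinarith

theorem lower_bound {K : Type*} [Field K] [Fintype K] [Fintype (ℙ K (Fin 3 → K))] {p : ℕ}
    [Fact p.Prime] (ι : ZMod p →+* K) (hp7 : 7 ≤ p) (hK : Nat.card K = p ^ 2)
    {c : ℙ K (Fin 3 → K) → ZMod p} (hc : c ∈ dualCode (desarguesianCode p K)) (hc0 : c ≠ 0) :
    2 * p ^ 2 + 5 ≤ hammingNorm c + 2 * p := by
  by_contra! hlt
  rw [mem_dualCode_code_iff] at hc
  have hq := (order_eq (K := K)).trans hK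
  have hw : hammingNorm c + 2 * p ≤ 2 * p ^ 2 + 4 := by omega
  obtain ⟨α, hα, hpos, htwo⟩ | ⟨hfull, hw'⟩ := two_valued_or_full _ hq hp7 hc hc0 hw
  · obtain ⟨x, hx⟩ := cnt_pos_iff.1 hpos
    have hα' : α⁻¹ ≠ 0 := inv_ne_zero hα
    obtain ⟨X, hX | hX⟩ := two_valued_structure (c := α⁻¹ • c) (ℙ K (Fin 3 → K)) hq hp7
      (fun l => by
        simp only [Pi.smul_apply, ← Finset.smul_sum, hc l, smul_zero])
      (by
        have h : hammingNorm (α⁻¹ • c) = hammingNorm c :=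
          hammingNorm_smul (fun _ => (IsUnit.mk0 _ hα').isSMulRegular _) c
        rwa [h])
      (cnt_pos_iff.2 ⟨x, by simp [hx, hα]⟩)
      fun z => by
        obtain h | h | h := htwo z <;> simp [h, hα]
    · exact not_planeLike ι hp7 X hX
    · exact not_antipodalLike ι hp7 X hX
  · obtain rfl | h11 : p = 7 ∨ 11 ≤ p := by
      have hp : p.Prime := Fact.out
      by_contra! h
      have : p < 11 := h.2
      interval_cases p
      · exact h.1 rfl
      · exact absurd hp (by norm_num)
      · exact absurd hp (by norm_num)
      · exact absurd hp (by norm_num)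
    · exact not_full_seven _ hq hc hw hw' hfull
    · exact not_full_of_eleven_le _ hq h11 hc hw hw' hfull

end PlaneCode

theorem mainTheorem2 (p : ℕ) (hp : p.Prime) (hp7 : 7 ≤ p)
    (K : Type*) [Field K] [Fintype (ℙ K (Fin 3 → K))] (hK : Nat.card K = p ^ 2) :
    ∃ d : ℕ, PlaneCode.IsMinWeight (PlaneCode.dualCode (PlaneCode.desarguesianCode p K)) d ∧
      2 * (p : ℤ) ^ 2 - 2 * (p : ℤ) + 5 ≤ (d : ℤ) ∧ (d : ℤ) ≤ 2 * (p : ℤ) ^ 2 - (p : ℤ) := by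
  have : Fact p.Prime := ⟨hp⟩
  have : Finite K := Nat.finite_of_card_ne_zero (by rw [hK]; exact pow_ne_zero _ hp.ne_zero)
  have : Fintype K := Fintype.ofFinite K
  have hK' : Fintype.card K = p ^ 2 := Nat.card_eq_fintype_card.symm.trans hK
  have : CharP K p := charP_of_card_eq_prime_pow hK'
  have ι : ZMod p →+* K := ZMod.castHom (dvd_refl p) K
  have hne : {w : ℕ | ∃ c ∈ PlaneCode.dualCode (PlaneCode.desarguesianCode p K),
      c ≠ 0 ∧ hammingNorm c = w}.Nonempty := by
    obtain ⟨c, hc, hc0, -⟩ := PlaneCode.exists_mem_dualCode ι hK'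
    exact ⟨_, c, hc, hc0, rfl⟩
  refine ⟨sInf {w : ℕ | ∃ c ∈ PlaneCode.dualCode (PlaneCode.desarguesianCode p K),
      c ≠ 0 ∧ hammingNorm c = w}, ⟨Nat.sInf_mem hne, fun w hw => Nat.sInf_le hw⟩, ?_, ?_⟩
  · obtain ⟨c, hc, hc0, hw⟩ := Nat.sInf_mem hne
    rw [← hw]
    have := PlaneCode.lower_bound ι hp7 hK hc hc0
    zify at this
    linarith
  · obtain ⟨c, hc, hc0, hw⟩ := PlaneCode.exists_mem_dualCode ι hK'
    have h1 := Nat.sInf_le (show hammingNorm c ∈ {w : ℕ | ∃ c ∈ PlaneCode.dualCode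
      (PlaneCode.desarguesianCode p K), c ≠ 0 ∧ hammingNorm c = w} from ⟨c, hc, hc0, rfl⟩)
    have h2 := h1.trans hw
    have h3 : p ≤ 2 * p ^ 2 := by nlinarith
    have h4 : ((2 * p ^ 2 - p : ℕ) : ℤ) = 2 * (p : ℤ) ^ 2 - p := by
      rw [Nat.cast_sub h3]
      push_cast
      rfl
    rw [← h4]
    exact Int.ofNat_le.2 h2
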